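/- **Definitions.** For $n\ge 0$, a permutation $\sigma$ of $[n]=\{1,\dots,n\}$ is identified with its diagram $\{(p,\sigma(p)) : p\in[n]\}$, and with the finite structure on the set of these points carrying the two strict total orders $<_P$ (comparison of first coordinates) and $<_V$ (comparison of second coordinates). A $\mathsf{TOTO}$ formula is a first-order formula with equality over the two binary relation symbols $<_P,<_V$. An *occurrence* of a permutation $\pi$ of $[k]$ in $\sigma$ is a sequence $\mathbf s=(s_1,\dots,s_k)$ of elements of $\sigma$, at increasing positions, whose values are in the same relative order as $\pi(1),\dots,\pi(k)$; if one exists, $\pi$ is a *subpermutation* of $\sigma$. The occurrence is *stable* if $\sigma$ maps the set of positions of $s_1,\dots,s_k$ to itself. A *permutation class* is a set of permutations closed under taking subpermutations; $\mathcal I$ and $\mathcal D$ are the classes of all increasing, respectively decreasing, permutations. The horizontal and vertical lines through the points of an occurrence $\mathbf s$ of $\pi$ in $\sigma$ cut the plane into a $(k+1)\times(k+1)$ grid of cells, with rows numbered from bottom to top and columns from left to right. Let $A(\sigma,\mathbf s)$ be the $(k+1)\times(k+1)$ matrix whose entry in row $a$ and column $b$ is the number of points of $\sigma$ outside $\mathbf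 s$ in the cell in row $a$ and column $b$. A *non-trivial cycle* on $[k+1]$ is a sequence $\mathbf i=(i_1,\dots,i_r)$ of $r\ge 2$ distinct elements of $[k+1]$. The *expansion* $E(\pi,\mathbf i)$ is the permutation of $[k+r]$ that has a stable occurrence $\mathbf s$ of $\pi$ for which $A(E(\pi,\mathbf i),\mathbf s)$ has entry $1$ in the positions $(i_1,i_2),(i_2,i_3),\dots,(i_{r-1},i_r),(i_r,i_1)$ and $0$ elsewhere. For permutations $\theta_1,\dots,\theta_r$, let $E(\pi,\mathbf i,(\theta_1,\dots,\theta_r))$ be the permutation obtained from $E(\pi,\mathbf i)$ by replacing the $r$ points outside $\mathbf s$, in left to right order, by blocks that are copies of the diagrams of $\theta_1,\dots,\theta_r$. For a sequence $\overline{\mathcal X}=(\mathcal X_1,\dots,\mathcal X_r)$ of permutation classes, $E(\pi,\mathbf i,\overline{\mathcal X})$ is the class of all subpermutations of the permutations $E(\pi,\mathbf i,(\theta_1,\dots,\theta_r))$ with $\theta_t\in\mathcal X_t$ for all $t$. **Theorem.** Let $\pi$ be a permutation of size $k$ and let $\mathcal C$ be a permutation class. The following are equivalent. 1. There is a $\mathsf{TOTO}$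 formula $\phi(x_1,\dots,x_k)$ such that for all $\sigma\in\mathcal C$ and all sequences $\mathbf s=(s_1,\dots,s_k)$ of elements of $\sigma$, $(\sigma,\mathbf s)\models\phi$ if and only if $\mathbf s$ is a stable occurrence of $\pi$ in $\sigma$. 2. For every non-trivial cycle $\mathbf i$ on $[k+1]$ and every sequence $\overline{\mathcal X}$ of the same length as $\mathbf i$ with all $\mathcal X_t\in\{\mathcal I,\mathcal D\}$, the class $\mathcal C$ does not contain $E(\pi,\mathbf i,\overline{\mathcal X})$, i.e. at least one permutation in $E(\pi,\mathbf i,\overline{\mathcal X})$ is not in $\mathcal C$. 3. There is a positive integer $M$ such that whenever $\sigma\in\mathcal C$ and $\mathbf s$ is a stable occurrence of $\pi$ in $\sigma$, the sum of the non-diagonal entries of $A(\sigma,\mathbf s)$ is at most $M$. -/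

import Mathlib

namespace TwoOrders

/-- Permutations of arbitrary finite size (size `0` included). A permutation of `[n]` is a
permutation of `Fin n`; positions and values are numbered from `0`. -/
abbrev FinPerm : Type := Σ n : ℕ, Equiv.Perm (Fin n)

/-! ### Patterns, permutation classes and stable occurrences -/

/-- `s` lists, from left to right, the positions of an occurrence of the pattern `π` in `σ`. -/
structure IsOccurrence {k n : ℕ} (π : Equiv.Perm (Fin k)) (σ : Equiv.Perm (Fin n))
    (s : Fin k → Fin n) : Prop where
  strictMono : StrictMono s
  lt_iff : ∀ a b : Fin k, π a < π b ↔ σ (s a) < σ (s b)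

/-- `τ` is a pattern (subpermutation) of `σ`. -/
def IsPattern (τ σ : FinPerm) : Prop :=
  ∃ s : Fin τ.1 → Fin σ.1, IsOccurrence τ.2 σ.2 s

/-- A permutation class: a set of permutations closed downward under taking patterns. -/
def IsPermClass (C : Set FinPerm) : Prop :=
  ∀ σ ∈ C, ∀ τ : FinPerm, IsPattern τ σ → τ ∈ C

/-- A stable occurrence of `π` in `σ`: an occurrence whose set of elements is mapped to itself
by `σ`. -/
structure IsStableOccurrence {k n : ℕ} (π : Equiv.Perm (Fin k)) (σ : Equiv.Perm (Fin n))
    (s : Fin k → Fin n) : Prop extends IsOccurrence π σ s where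
  mapsTo : Set.MapsTo σ (Set.range s) (Set.range s)

/-! ### First-order logic: the theory of two orders -/

/-- The two binary relation symbols: position order and value order. -/
inductive TotoRel : ℕ → Type
  | ltP : TotoRel 2
  | ltV : TotoRel 2

/-- The signature of the theory of two orders (equality is part of the logic). -/
def toto : FirstOrder.Language.{0, 0} := ⟨fun _ => Empty, TotoRel⟩

/-- The model of the theory of two orders given by a permutation `σ`. The element `(i, σ i)` of
the diagram of `σ` is represented by its position `i`. -/
@[reducible] def totoStructure {n : ℕ} (σ : Equiv.Perm (Fin n)) : toto.Structure (Fin n) where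
  funMap := fun f _ => nomatch f
  RelMap := fun {_} R =>
    match R with
    | TotoRel.ltP => fun v => v 0 < v 1
    | TotoRel.ltV => fun v => σ (v 0) < σ (v 1)

/-- `(σ, a) ⊨ φ`, for a formula `φ` whose free variables are among `x₁, …, x_k`. -/
def Satisfies {k n : ℕ} (σ : Equiv.Perm (Fin n)) (a : Fin k → Fin n)
    (φ : toto.Formula (Fin k)) : Prop :=
  letI := totoStructure σ
  φ.Realize a

/-! ### The cell matrix of an occurrence -/

/-- The number of `t` with `f t < x`: the index of the row (or column) of the grid cut out by the
values `f t` in which `x` lies. -/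
def gridIndex {k n : ℕ} (f : Fin k → Fin n) (x : Fin n) : Fin (k + 1) :=
  ⟨(Finset.univ.filter fun t => f t < x).card, by
    have h := Finset.card_filter_le (Finset.univ : Finset (Fin k)) (fun t => f t < x)
    simp only [Finset.card_univ, Fintype.card_fin] at h
    omega⟩

/-- `A(σ, s)`: the entry in row `i` (rows numbered from bottom to top) and column `j` is the number
of elements of `σ` outside `s` that lie in the cell in row `i` and column `j` of the grid cut out by
the points of `s`. -/
def cellMatrix {k n : ℕ} (σ : Equiv.Perm (Fin n)) (s : Fin k → Fin n) :
    Matrix (Fin (k + 1)) (Fin (k + 1)) ℕ :=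
  Matrix.of fun i j =>
    (Finset.univ.filter fun p : Fin n =>
      (∀ t, p ≠ s t) ∧ gridIndex (fun t => σ (s t)) (σ p) = i ∧ gridIndex s p = j).card

/-- The sum of the non-diagonal entries of a square matrix. -/
def offDiagSum {m : ℕ} (A : Matrix (Fin m) (Fin m) ℕ) : ℕ :=
  ∑ i, ∑ j, if i = j then 0 else A i j

/-! ### Inflations and the classes `E(π, i, X)` -/

/-- The enumeration of a finite set in increasing order of an injective coordinate `f`. -/
noncomputable def enumerateBy {α β : Type} [Fintype α] [LinearOrder β] (f : α → β)
    (hf : Function.Injective f) : Fin (Fintype.card α) ≃ α :=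
  letI : LinearOrder α := LinearOrder.lift' f hf
  (Fintype.orderIsoFinOfCardEq α rfl).toEquiv

/-- The permutation of a finite set of points with first coordinate `x` and second coordinate `y`:
it maps the rank of each point from left to right to its rank from bottom to top. -/
noncomputable def permOfPoints {α β γ : Type} [Fintype α] [LinearOrder β] [LinearOrder γ]
    (x : α → β) (y : α → γ) (hx : Function.Injective x) (hy : Function.Injective y) : FinPerm :=
  ⟨Fintype.card α, (enumerateBy x hx).trans (enumerateBy y hy).symm⟩

/-- One coordinate of the points that appear when each point `a` is replaced by a block: points are
compared by the coordinate `f a` of the block and then by the coordinate `g a` inside it. -/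
def blockCoord {α β : Type} (f : α → β) {m : α → ℕ} (g : ∀ a, Fin (m a) → Fin (m a))
    (p : Σ a, Fin (m a)) : β ×ₗ ℕ :=
  toLex (f p.1, (g p.1 p.2 : ℕ))

theorem blockCoord_injective {α β : Type} {f : α → β} (hf : Function.Injective f) {m : α → ℕ}
    {g : ∀ a, Fin (m a) → Fin (m a)} (hg : ∀ a, Function.Injective (g a)) :
    Function.Injective (blockCoord f g) := by
  rintro ⟨a, p⟩ ⟨b, q⟩ h
  have h' := congrArg ofLex h
  simp only [blockCoord, ofLex_toLex, Prod.mk.injEq] at h'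
  obtain ⟨h1, h2⟩ := h'
  obtain rfl := hf h1
  obtain rfl := hg a (Fin.ext h2)
  rfl

/-- Inflation: the point `a` of the diagram with coordinates `(x a, y a)` is replaced by the diagram
of `θ a`. For the diagram of `π`, i.e. `α = Fin k`, `x = id`, `y = π`, this is `π[θ₁, …, θ_k]`. -/
noncomputable def inflate {α β γ : Type} [Fintype α] [LinearOrder β] [LinearOrder γ]
    (x : α → β) (y : α → γ) (hx : Function.Injective x) (hy : Function.Injective y)
    (θ : α → FinPerm) : FinPerm :=
  permOfPoints (blockCoord x fun a => (id : Fin (θ a).1 → Fin (θ a).1))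
    (blockCoord y fun a => ⇑(θ a).2)
    (blockCoord_injective hx fun _ => Function.injective_id)
    (blockCoord_injective hy fun a => (θ a).2.injective)

section Expansion

variable {k r : ℕ}

/-- First coordinates in the diagram of the expansion `E(π, i)`. The point `j` of `π` has
coordinate `2j + 1`, and the `c`-th column of the grid cut out by these points (`0 ≤ c ≤ k`) is
represented by the coordinate `2c`. The new points are numbered from left to right, so their columns
are the elements of `i` in increasing order. -/
def expansionX (i : Fin r ↪ Fin (k + 1)) : Fin k ⊕ Fin r → ℕ :=
  Sum.elim (fun j => 2 * (j : ℕ) + 1) (fun t => 2 * (i (Tuple.sort i t) : ℕ))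

/-- Second coordinates in the diagram of the expansion `E(π, i)`, with the same convention for rows.
The new point in column `i_{t+1}` lies in row `i_t`, indices being taken cyclically: the new points
have cell matrix equal to the adjacency matrix of the directed cycle `i₁ → i₂ → ⋯ → i_r → i₁`. -/
def expansionY (π : Equiv.Perm (Fin k)) (i : Fin r ↪ Fin (k + 1)) : Fin k ⊕ Fin r → ℕ :=
  Sum.elim (fun j => 2 * (π j : ℕ) + 1)
    (fun t => 2 * (i ((finRotate r).symm (Tuple.sort i t)) : ℕ))

theorem expansionX_injective (i : Fin r ↪ Fin (k + 1)) : Function.Injective (expansionX i) := by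
  rintro (a | a) (b | b) h <;> simp only [expansionX, Sum.elim_inl, Sum.elim_inr] at h
  · exact congrArg _ (Fin.ext (by omega))
  · omega
  · omega
  · exact congrArg _ ((Tuple.sort i).injective (i.injective (Fin.ext (by omega))))

theorem expansionY_injective (π : Equiv.Perm (Fin k)) (i : Fin r ↪ Fin (k + 1)) :
    Function.Injective (expansionY π i) := by
  rintro (a | a) (b | b) h <;> simp only [expansionY, Sum.elim_inl, Sum.elim_inr] at h
  · exact congrArg _ (π.injective (Fin.ext (by omega)))
  · omega
  · omega
  · exact congrArg _ ((Tuple.sort i).injective ((finRotate r).symm.injective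
      (i.injective (Fin.ext (by omega)))))

/-- `E(π, i, Θ)`: the new points of the expansion `E(π, i)` are inflated, in left to right order, by
`θ₁, …, θ_r`, while the points of `π` are left as they are. -/
noncomputable def expansionInflation (π : Equiv.Perm (Fin k)) (i : Fin r ↪ Fin (k + 1))
    (Θ : Fin r → FinPerm) : FinPerm :=
  inflate (expansionX i) (expansionY π i) (expansionX_injective i) (expansionY_injective π i)
    (Sum.elim (fun _ => ⟨1, 1⟩) Θ)

/-- `E(π, i, X)`: all subpermutations of the permutations `E(π, i, Θ)` with `θ_t ∈ X_t`. -/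
def expansionClass (π : Equiv.Perm (Fin k)) (i : Fin r ↪ Fin (k + 1))
    (X : Fin r → Set FinPerm) : Set FinPerm :=
  {τ | ∃ Θ : Fin r → FinPerm, (∀ t, Θ t ∈ X t) ∧ IsPattern τ (expansionInflation π i Θ)}

end Expansion

/-- The class of monotone increasing permutations. -/
def increasingClass : Set FinPerm := {τ | StrictMono τ.2}

/-- The class of monotone decreasing permutations. -/
def decreasingClass : Set FinPerm := {τ | StrictAnti τ.2}

end TwoOrders

/-! Stability of an occurrence can be read off its cell matrix. The position of a point of the
occurrence is the number of occurrence points to its left plus the column sums of the strips to its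
left; its value is computed in the same way from row sums. Hence an occurrence is stable exactly
when each row sum equals the column sum of the same index (`IsStableOccurrence.isBalanced`,
`IsOccurrence.isStableOccurrence_of_isBalanced`). A diagonal entry counts equally in both sums, so
only the off-diagonal entries matter.

If these entries are bounded on stable occurrences, only finitely many balanced off-diagonal
patterns are possible, and a finite disjunction of counting formulas defines stability
(`exists_formula_of_bound`).

If they are unbounded, regard the matrix as a circulation on `k + 1` vertices. A large circulation
without loops contains a cycle all of whose edges are heavy (`exists_cycle_of_isBalanced`). Every
cell on that cycle holds a long monotone sequence (`exists_monotone_subset`), so any prescribed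
monotone inflation of some expansion occurs as a pattern (`exists_bound_offDiagSum`).

If the class contains some `E(π, i, X)`, inflate all new points of the expansion by monotone blocks
of size `2 ^ q`: the copy of `π` is stable. One further point in a single block destroys stability,
because that block lies off the diagonal. Yet `q` rounds of an Ehrenfeucht–Fraïssé game cannot tell
the two permutations apart (`IsWinning.gameEquivalent`), so no formula defines stability
(`exists_notMem_of_definable`). -/

namespace TwoOrders

/-! ### The grid of an occurrence -/

theorem card_filter_perm_lt {k : ℕ} (ρ : Equiv.Perm (Fin k)) (c : ℕ) (hc : c ≤ k) :
    (Finset.univ.filter fun t => (ρ t : ℕ) < c).card = c := by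
  have h : (Finset.univ.filter fun t => (ρ t : ℕ) < c).map ρ.toEmbedding
      = Finset.univ.filter fun t : Fin k => (t : ℕ) < c := by
    ext t
    simp only [Finset.mem_map_equiv, Finset.mem_filter, Finset.mem_univ, true_and,
      Equiv.apply_symm_apply]
  rw [← Finset.card_map ρ.toEmbedding, h, Fin.card_filter_val_lt, min_eq_right hc]

/-- Here `ρ` is the relative order of the grid lines `f`; `ρ = 1` serves for columns and `ρ = π` for
rows. The `ρ j + 1` lines of rank at most `ρ j` all lie below `y`. -/
theorem lt_gridIndex_of_lt {k n : ℕ} {ρ : Equiv.Perm (Fin k)} {f : Fin k → Fin n}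
    (hf : ∀ a b, ρ a < ρ b → f a < f b) {j : Fin k} {y : Fin n} (h : f j < y) :
    (ρ j : ℕ) < gridIndex f y := by
  have h1 := card_filter_perm_lt ρ (ρ j + 1) (ρ j).isLt
  have h2 : (Finset.univ.filter fun t => (ρ t : ℕ) < ρ j + 1) ⊆
      Finset.univ.filter fun t => f t < y := by
    intro t ht
    simp only [Finset.mem_filter, Finset.mem_univ, true_and] at ht ⊢
    rcases (Nat.lt_succ_iff.mp ht).lt_or_eq with h' | h'
    · exact (hf t j h').trans h
    · rw [ρ.injective (Fin.ext h')]
      exact h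
  have h3 := Finset.card_le_card h2
  rw [h1] at h3
  exact h3

theorem gridIndex_le_of_lt {k n : ℕ} {ρ : Equiv.Perm (Fin k)} {f : Fin k → Fin n}
    (hf : ∀ a b, ρ a < ρ b → f a < f b) {j : Fin k} {y : Fin n} (h : y < f j) :
    (gridIndex f y : ℕ) ≤ ρ j := by
  have h1 := card_filter_perm_lt ρ (ρ j) (ρ j).isLt.le
  have h2 : (Finset.univ.filter fun t => f t < y) ⊆
      Finset.univ.filter fun t => (ρ t : ℕ) < ρ j := by
    intro t ht
    simp only [Finset.mem_filter, Finset.mem_univ, true_and] at ht ⊢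
    by_contra hlt
    rcases (not_lt.mp hlt).lt_or_eq with h' | h'
    · exact absurd (ht.trans (h.trans (hf j t h'))) (lt_irrefl _)
    · rw [ρ.injective (Fin.ext h')] at h
      exact absurd (ht.trans h) (lt_irrefl _)
  have h3 := Finset.card_le_card h2
  rw [h1] at h3
  exact h3

theorem lt_iff_gridIndex_le {k n : ℕ} {ρ : Equiv.Perm (Fin k)} {f : Fin k → Fin n}
    (hf : ∀ a b, ρ a < ρ b → f a < f b) {j : Fin k} {y : Fin n} (hy : y ≠ f j) :
    y < f j ↔ (gridIndex f y : ℕ) ≤ ρ j := by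
  refine ⟨gridIndex_le_of_lt hf, fun h => ?_⟩
  rcases lt_or_gt_of_ne hy with h' | h'
  · exact h'
  · exact absurd (lt_gridIndex_of_lt hf h') (not_lt.mpr h)

theorem gridIndex_mono {k n : ℕ} (f : Fin k → Fin n) {y z : Fin n} (h : y ≤ z) :
    gridIndex f y ≤ gridIndex f z :=
  show (Finset.univ.filter fun t => f t < y).card ≤ (Finset.univ.filter fun t => f t < z).card from
    Finset.card_le_card <| Finset.monotone_filter_right _ fun _ _ ht => lt_of_lt_of_le ht h

theorem gridIndex_comp_perm {k n : ℕ} (f : Fin k → Fin n) (ρ : Equiv.Perm (Fin k)) (y : Fin n) :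
    gridIndex (fun t => f (ρ t)) y = gridIndex f y := by
  refine Fin.ext ?_
  change (Finset.univ.filter fun t => f (ρ t) < y).card = (Finset.univ.filter fun t => f t < y).card
  rw [← Finset.card_map ρ.toEmbedding]
  congr 1
  ext t
  simp

/-! ### Stable occurrences and row and column sums -/

variable {k n : ℕ} {π : Equiv.Perm (Fin k)} {σ : Equiv.Perm (Fin n)} {s : Fin k → Fin n}

/-- The self-map of the indices induced by `σ`, composed with the inverse of `π`, is strictly
increasing on `Fin k` and hence the identity. -/
theorem IsStableOccurrence.apply_eq (h : IsStableOccurrence π σ s) (j : Fin k) :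
    σ (s j) = s (π j) := by
  choose ρ hρ using fun j => h.mapsTo (Set.mem_range_self (f := s) j)
  have hmono : StrictMono fun a => ρ (π.symm a) := by
    intro a b hab
    rw [← h.strictMono.lt_iff_lt, hρ, hρ, ← h.lt_iff]
    simpa using hab
  have hsurj : Function.Surjective fun a => ρ (π.symm a) :=
    Finite.injective_iff_surjective.mp hmono.injective
  have hid : (fun a => ρ (π.symm a)) = id :=
    (hmono.range_inj strictMono_id).mp (by rw [hsurj.range_eq, Set.range_id])
  have := congrFun hid (π j)
  simp only [Equiv.symm_apply_apply, id] at this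
  rw [← hρ, this]

theorem IsOccurrence.isStableOccurrence (h : IsOccurrence π σ s)
    (hs : ∀ j, σ (s j) = s (π j)) : IsStableOccurrence π σ s :=
  ⟨h, by
    rintro _ ⟨j, rfl⟩
    exact ⟨π j, (hs j).symm⟩⟩

/-- The `a`-th row sum equals the `a`-th column sum, for all `a`. -/
def IsBalanced {V : Type} [Fintype V] (A : V → V → ℕ) : Prop :=
  ∀ a, ∑ b, A a b = ∑ b, A b a

theorem sum_row_cellMatrix (σ : Equiv.Perm (Fin n)) (s : Fin k → Fin n) (a : Fin (k + 1)) :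
    ∑ b, cellMatrix σ s a b = (Finset.univ.filter fun p : Fin n =>
      (∀ t, p ≠ s t) ∧ gridIndex (fun t => σ (s t)) (σ p) = a).card := by
  rw [Finset.card_eq_sum_card_fiberwise (f := fun p => gridIndex s p) (t := Finset.univ)
    (fun _ _ => Finset.mem_coe.mpr (Finset.mem_univ _))]
  refine Finset.sum_congr rfl fun b _ => ?_
  simp only [cellMatrix, Matrix.of_apply, Finset.filter_filter, and_assoc]

theorem sum_col_cellMatrix (σ : Equiv.Perm (Fin n)) (s : Fin k → Fin n) (b : Fin (k + 1)) :
    ∑ a, cellMatrix σ s a b = (Finset.univ.filter fun p : Fin n =>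
      (∀ t, p ≠ s t) ∧ gridIndex s p = b).card := by
  rw [Finset.card_eq_sum_card_fiberwise (f := fun p => gridIndex (fun t => σ (s t)) (σ p))
    (t := Finset.univ) (fun _ _ => Finset.mem_coe.mpr (Finset.mem_univ _))]
  refine Finset.sum_congr rfl fun a _ => ?_
  simp only [cellMatrix, Matrix.of_apply, Finset.filter_filter, and_assoc]
  congr 1
  ext p
  simp only [Finset.mem_filter, Finset.mem_univ, true_and]
  tauto

/-- Positions and values of a stable occurrence are the same set of numbers, so row strips and
column strips have the same boundaries. Sending `p` to `σ p` is then a bijection from the outside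
points of row `a` to those of column `a`. -/
theorem IsStableOccurrence.isBalanced (h : IsStableOccurrence π σ s) :
    IsBalanced (cellMatrix σ s) := by
  intro a
  rw [sum_row_cellMatrix, sum_col_cellMatrix, ← Finset.card_map σ.toEmbedding]
  congr 1
  ext p
  simp only [Finset.mem_map_equiv, Finset.mem_filter, Finset.mem_univ, true_and,
    Equiv.apply_symm_apply, h.apply_eq]
  rw [gridIndex_comp_perm s π]
  refine and_congr_left fun _ => ⟨fun hp t hpt => ?_, fun hp t hpt => ?_⟩
  · apply hp (π.symm t)
    rw [Equiv.symm_apply_eq, h.apply_eq, Equiv.apply_symm_apply, hpt]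
  · apply hp (π t)
    rw [← h.apply_eq, ← hpt, Equiv.apply_symm_apply]

/-- The coordinate of a point of an occurrence, computed from the numbers of points outside the
occurrence in the strips of the grid. -/
theorem coord_eq_add_sum_strips (hs : Function.Injective s) (τ : Equiv.Perm (Fin n))
    {ρ : Equiv.Perm (Fin k)} (hτ : ∀ a b, ρ a < ρ b → τ (s a) < τ (s b)) (j : Fin k) :
    (τ (s j) : ℕ) = ρ j + ∑ a ∈ Finset.univ.filter (fun a : Fin (k + 1) => (a : ℕ) ≤ ρ j),
      (Finset.univ.filter fun p : Fin n =>
        (∀ t, p ≠ s t) ∧ gridIndex (fun t => τ (s t)) (τ p) = a).card := by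
  have h1 := card_filter_perm_lt τ (τ (s j)) (τ (s j)).isLt.le
  have hiff : ∀ a b, ρ a < ρ b ↔ τ (s a) < τ (s b) := by
    refine fun a b => ⟨hτ a b, fun hab => ?_⟩
    rcases lt_trichotomy (ρ a) (ρ b) with h' | h' | h'
    · exact h'
    · rw [ρ.injective h'] at hab
      exact absurd hab (lt_irrefl _)
    · exact absurd (hab.trans (hτ _ _ h')) (lt_irrefl _)
  rw [← h1, ← Finset.card_filter_add_card_filter_not (fun p => ∃ t, p = s t)]
  congr 1
  · have h2 := card_filter_perm_lt ρ (ρ j) (ρ j).isLt.le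
    rw [← h2, ← Finset.card_map ⟨s, hs⟩]
    congr 1
    ext p
    simp only [Finset.mem_map, Finset.mem_filter, Finset.mem_univ, true_and,
      Function.Embedding.coeFn_mk]
    constructor
    · rintro ⟨hp, t, rfl⟩
      exact ⟨t, (hiff t j).mpr hp, rfl⟩
    · rintro ⟨t, ht, rfl⟩
      exact ⟨hτ t j ht, t, rfl⟩
  · rw [Finset.card_eq_sum_card_fiberwise (f := fun p => gridIndex (fun t => τ (s t)) (τ p))
      (t := Finset.univ.filter (fun a : Fin (k + 1) => (a : ℕ) ≤ ρ j))]
    · refine Finset.sum_congr rfl fun a ha => ?_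
      congr 1
      ext p
      simp only [Finset.mem_filter, Finset.mem_univ, true_and, not_exists] at ha ⊢
      constructor
      · rintro ⟨⟨_, hp⟩, rfl⟩
        exact ⟨hp, rfl⟩
      · rintro ⟨hp, rfl⟩
        exact ⟨⟨(lt_iff_gridIndex_le (f := fun t => τ (s t)) hτ
          (fun e => hp j (τ.injective e))).mpr ha, hp⟩, rfl⟩
    · intro p hp
      simp only [Finset.coe_filter, Finset.mem_filter, Finset.mem_univ, true_and,
        Set.mem_ofPred_eq] at hp ⊢
      exact gridIndex_le_of_lt (f := fun t => τ (s t)) hτ hp.1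

/-- By `coord_eq_add_sum_strips`, both `σ (s j)` and `s (π j)` equal `π j` plus the strip sums of
index at most `π j`, over rows for the first and columns for the second; balance identifies them. -/
theorem IsOccurrence.isStableOccurrence_of_isBalanced (h : IsOccurrence π σ s)
    (hb : IsBalanced (cellMatrix σ s)) : IsStableOccurrence π σ s := by
  refine h.isStableOccurrence fun j => Fin.ext ?_
  have h1 := coord_eq_add_sum_strips h.strictMono.injective σ (ρ := π)
    (fun a b => (h.lt_iff a b).mp) j
  have h2 := coord_eq_add_sum_strips h.strictMono.injective 1 (ρ := 1)
    (fun a b hab => h.strictMono hab) (π j)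
  simp only [Equiv.Perm.one_apply] at h2
  rw [h1, h2]
  congr 1
  refine Finset.sum_congr rfl fun a _ => ?_
  rw [← sum_row_cellMatrix, hb a, sum_col_cellMatrix]
  rfl

/-- The matrix with its diagonal entries replaced by `0`. -/
def offDiag {V : Type} [DecidableEq V] (A : V → V → ℕ) (a b : V) : ℕ :=
  if a = b then 0 else A a b

theorem isBalanced_offDiag_iff {V : Type} [Fintype V] [DecidableEq V] {A : V → V → ℕ} :
    IsBalanced (offDiag A) ↔ IsBalanced A := by
  refine forall_congr' fun a => ?_
  have h1 : ∑ b, A a b = ∑ b, offDiag A a b + A a a := by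
    rw [← Finset.sum_erase_add _ _ (Finset.mem_univ a),
      ← Finset.sum_erase_add _ (fun b => offDiag A a b) (Finset.mem_univ a)]
    simp only [offDiag, if_true, add_zero]
    congr 1
    exact Finset.sum_congr rfl fun b hb => (if_neg (Finset.ne_of_mem_erase hb).symm).symm
  have h2 : ∑ b, A b a = ∑ b, offDiag A b a + A a a := by
    rw [← Finset.sum_erase_add _ _ (Finset.mem_univ a),
      ← Finset.sum_erase_add _ (fun b => offDiag A b a) (Finset.mem_univ a)]
    simp only [offDiag, if_true, add_zero]
    congr 1
    exact Finset.sum_congr rfl fun b hb => (if_neg (Finset.ne_of_mem_erase hb)).symm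
  omega

/-! ### Cycles of large entries in a balanced matrix -/

/-- Follow the heaviest outgoing edge from a vertex of large outflow. That edge carries at least a
`1 / K` share of the outflow, and by balance its head sends out at least as much as the edge brings
in. The flow thus shrinks by a factor of at most `K` per step, and the walk must close up. -/
theorem exists_cycle_of_isBalanced {V : Type} [Fintype V] {B : V → V → ℕ} (hB : IsBalanced B)
    (hdiag : ∀ v, B v v = 0) {N : ℕ}
    (hN : Fintype.card V * (Fintype.card V ^ (2 * Fintype.card V + 1) * N) < ∑ a, ∑ b, B a b) :
    ∃ r, 2 ≤ r ∧ ∃ i : Fin r ↪ V, ∀ t, N ≤ B (i t) (i (finRotate r t)) := by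
  classical
  set K := Fintype.card V with hK
  obtain ⟨v₀, hv₀⟩ : ∃ v₀, K ^ (2 * K + 1) * N < ∑ b, B v₀ b := by
    by_contra! hcon
    have := Finset.sum_le_card_nsmul Finset.univ (fun a => ∑ b, B a b) _ fun a _ => hcon a
    rw [Finset.card_univ, smul_eq_mul] at this
    exact absurd hN (not_lt.mpr this)
  have : Nonempty V := ⟨v₀⟩
  have hKpos : 0 < K := Fintype.card_pos
  choose f hf using fun v => Finite.exists_max (B v)
  have hout : ∀ v, ∑ b, B v b ≤ K * B v (f v) := fun v => by
    have := Finset.sum_le_card_nsmul Finset.univ (B v) _ fun b _ => hf v b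
    rwa [Finset.card_univ, smul_eq_mul] at this
  have hstep : ∀ v, B v (f v) ≤ ∑ b, B (f v) b := fun v => by
    rw [hB (f v)]
    exact Finset.single_le_sum (f := fun b => B b (f v)) (fun _ _ => Nat.zero_le _)
      (Finset.mem_univ v)
  have hiter : ∀ m, ∑ b, B v₀ b ≤ K ^ m * ∑ b, B (f^[m] v₀) b := by
    intro m
    induction m with
    | zero => simp
    | succ m ih =>
      rw [Function.iterate_succ_apply', pow_succ, mul_assoc]
      exact ih.trans (Nat.mul_le_mul_left _
        ((hout _).trans (Nat.mul_le_mul_left _ (hstep _))))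
  -- The tail before the cycle and the cycle itself each have length at most `K`, so edges up to
  -- step `2 * K` are needed; the edge at step `m` costs a factor `K ^ (m + 1)`.
  have hedge : ∀ m, m ≤ 2 * K → N < B (f^[m] v₀) (f (f^[m] v₀)) := by
    intro m hm
    have h1 : K ^ (2 * K + 1) * N < K ^ (2 * K + 1) * B (f^[m] v₀) (f (f^[m] v₀)) := by
      refine hv₀.trans_le ((hiter m).trans ?_)
      calc _ ≤ K ^ m * (K * B (f^[m] v₀) (f (f^[m] v₀))) := Nat.mul_le_mul_left _ (hout _)
        _ = K ^ (m + 1) * B (f^[m] v₀) (f (f^[m] v₀)) := by ring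
        _ ≤ _ := Nat.mul_le_mul_right _ (Nat.pow_le_pow_right hKpos (by omega))
    exact Nat.lt_of_mul_lt_mul_left h1
  obtain ⟨a, b, hab, hfab⟩ := Fintype.exists_ne_map_eq_of_card_lt
    (fun a : Fin (K + 1) => f^[a] v₀) (by simp [hK])
  wlog hlt : a < b generalizing a b
  · exact this b a hab.symm hfab.symm (lt_of_le_of_ne (not_lt.mp hlt) hab.symm)
  set p := f^[a] v₀ with hp
  have hper : Function.IsPeriodicPt f (b - a : ℕ) p := by
    change f^[(b - a : ℕ)] p = p
    rw [hp, ← Function.iterate_add_apply, Nat.sub_add_cancel (le_of_lt hlt)]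
    exact hfab.symm
  have hbpos : 0 < (b - a : ℕ) := Nat.sub_pos_of_lt hlt
  have hrle := hper.minimalPeriod_le hbpos
  have hrpos := hper.minimalPeriod_pos hbpos
  have hiterp : ∀ m, f^[m] p = f^[m + a] v₀ := fun m => by
    rw [hp, ← Function.iterate_add_apply]
  have hedge' : ∀ m, m ≤ K → N < B (f^[m] p) (f (f^[m] p)) := fun m hm => by
    rw [hiterp]
    exact hedge _ (by have := a.isLt; omega)
  have hrle' : Function.minimalPeriod f p ≤ K := by have := b.isLt; omega
  refine ⟨Function.minimalPeriod f p, ?_, ⟨fun t => f^[t] p, fun t u htu => ?_⟩, fun t => ?_⟩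
  -- Period one would be a loop, whose entry is `0` by `hdiag` and yet exceeds `N`.
  · by_contra hlt2
    have h1 : Function.minimalPeriod f p = 1 := by omega
    have h2 : f p = p := Function.minimalPeriod_eq_one_iff_isFixedPt.mp h1
    have h3 := hedge' 0 (Nat.zero_le _)
    simp only [Function.iterate_zero, id, h2, hdiag] at h3
    omega
  · exact Fin.ext (Function.iterate_injOn_Iio_minimalPeriod t.isLt u.isLt htu)
  · have h1 : f^[(finRotate _ t : Fin _)] p = f (f^[t] p) := by
      rw [← Function.iterate_succ_apply' f]
      obtain ⟨r, hr⟩ : ∃ r, Function.minimalPeriod f p = r + 1 := ⟨_, (Nat.succ_pred hrpos.ne').symm⟩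
      -- The period is replaced by a variable so that it can be rewritten as a successor, as
      -- `coe_finRotate` requires.
      have key : ∀ r', r' = Function.minimalPeriod f p → ∀ t : Fin r',
          f^[(finRotate r' t : Fin r')] p = f^[t + 1] p := by
        intro r' hr' t
        obtain ⟨r'', rfl⟩ : ∃ r'', r' = r'' + 1 := ⟨r, by omega⟩
        rw [coe_finRotate]
        split_ifs with ht
        · rw [ht, Fin.val_last, hr', Function.iterate_minimalPeriod]
          rfl
        · rfl
      exact key _ rfl t
    change N ≤ B (f^[t] p) (f^[(finRotate _ t : Fin _)] p)
    rw [h1]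
    exact (hedge' t (t.isLt.le.trans hrle')).le

/-! ### Monotone subsequences -/

/-- A weak form of Erdős–Szekeres, with a crude bound that suffices. The points right of the
leftmost point `p` split into those above and those below it; one part has at least half of `2 ^ (a
+ b)` points, and `p` extends an increasing sequence above it or a decreasing one below it. -/
theorem exists_monotone_subset (σ : Equiv.Perm (Fin n)) (a b : ℕ) (S : Finset (Fin n))
    (hS : 2 ^ (a + b) ≤ S.card) :
    (∃ T ⊆ S, T.card = a ∧ ∀ x ∈ T, ∀ y ∈ T, x < y → σ x < σ y) ∨
      ∃ T ⊆ S, T.card = b ∧ ∀ x ∈ T, ∀ y ∈ T, x < y → σ y < σ x := by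
  induction h : a + b generalizing a b S with
  | zero =>
    exact Or.inl ⟨∅, by simp, by simp; omega, by simp⟩
  | succ m ih =>
    rcases Nat.eq_zero_or_pos a with rfl | ha
    · exact Or.inl ⟨∅, by simp, by simp, by simp⟩
    rcases Nat.eq_zero_or_pos b with rfl | hb
    · exact Or.inr ⟨∅, by simp, by simp, by simp⟩
    have hne : S.Nonempty := Finset.card_pos.mp (lt_of_lt_of_le (by positivity) hS)
    set p := S.min' hne with hp
    have hmin : ∀ x ∈ S, x ≠ p → p < x := fun x hx hxp =>
      lt_of_le_of_ne (S.min'_le x hx) hxp.symm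
    have hcard := Finset.card_filter_add_card_filter_not (s := S.erase p) (fun x => σ p < σ x)
    rw [Finset.card_erase_of_mem (S.min'_mem hne)] at hcard
    rw [h, pow_succ] at hS
    have hsub : ∀ q : Fin n → Prop, ∀ [DecidablePred q], (S.erase p).filter q ⊆ S := fun q _ =>
      (Finset.filter_subset _ _).trans (Finset.erase_subset _ _)
    by_cases hU : 2 ^ m ≤ ((S.erase p).filter fun x => σ p < σ x).card
    · rcases ih (a - 1) b _ (by rwa [show a - 1 + b = m by omega]) (by omega) with
        ⟨T, hT, hc, hm⟩ | ⟨T, hT, hc, hm⟩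
      · have hT' : ∀ x ∈ T, x ≠ p ∧ x ∈ S ∧ σ p < σ x := fun x hx => by
          have := hT hx
          simp only [Finset.mem_filter, Finset.mem_erase] at this
          exact ⟨this.1.1, this.1.2, this.2⟩
        refine Or.inl ⟨insert p T, ?_, ?_, ?_⟩
        · exact Finset.insert_subset (S.min'_mem hne) (hT.trans (hsub _))
        · rw [Finset.card_insert_of_notMem fun hpT => (hT' p hpT).1 rfl]
          omega
        · intro x hx y hy hxy
          rcases Finset.mem_insert.mp hx with rfl | hx <;>
            rcases Finset.mem_insert.mp hy with rfl | hy
          · exact absurd hxy (lt_irrefl _)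
          · exact (hT' y hy).2.2
          · exact absurd (hmin x (hT' x hx).2.1 (hT' x hx).1) hxy.asymm
          · exact hm x hx y hy hxy
      · exact Or.inr ⟨T, hT.trans (hsub _), hc, hm⟩
    · have hD : 2 ^ m ≤ ((S.erase p).filter fun x => ¬ σ p < σ x).card := by
        have := Nat.one_le_two_pow (n := m)
        omega
      rcases ih a (b - 1) _ (by rwa [show a + (b - 1) = m by omega]) (by omega) with
        ⟨T, hT, hc, hm⟩ | ⟨T, hT, hc, hm⟩
      · exact Or.inl ⟨T, hT.trans (hsub _), hc, hm⟩
      · have hT' : ∀ x ∈ T, x ≠ p ∧ x ∈ S ∧ σ x < σ p := fun x hx => by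
          have := hT hx
          simp only [Finset.mem_filter, Finset.mem_erase] at this
          exact ⟨this.1.1, this.1.2, lt_of_le_of_ne (not_lt.mp this.2)
            fun e => this.1.1 (σ.injective e)⟩
        refine Or.inr ⟨insert p T, ?_, ?_, ?_⟩
        · exact Finset.insert_subset (S.min'_mem hne) (hT.trans (hsub _))
        · rw [Finset.card_insert_of_notMem fun hpT => (hT' p hpT).1 rfl]
          omega
        · intro x hx y hy hxy
          rcases Finset.mem_insert.mp hx with rfl | hx <;>
            rcases Finset.mem_insert.mp hy with rfl | hy
          · exact absurd hxy (lt_irrefl _)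
          · exact (hT' y hy).2.2
          · exact absurd (hmin x (hT' x hx).2.1 (hT' x hx).1) hxy.asymm
          · exact hm x hx y hy hxy

/-! ### Patterns in permutations given by points -/

theorem enumerateBy_lt_iff {α β : Type} [Fintype α] [LinearOrder β] (f : α → β)
    (hf : Function.Injective f) (i j : Fin (Fintype.card α)) :
    f (enumerateBy f hf i) < f (enumerateBy f hf j) ↔ i < j :=
  letI : LinearOrder α := LinearOrder.lift' f hf
  (Fintype.orderIsoFinOfCardEq α rfl).lt_iff_lt

theorem permOfPoints_lt_iff {α β γ : Type} [Fintype α] [LinearOrder β] [LinearOrder γ]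
    (x : α → β) (y : α → γ) (hx : Function.Injective x) (hy : Function.Injective y)
    (i j : Fin (Fintype.card α)) :
    ((enumerateBy x hx).trans (enumerateBy y hy).symm) i <
        ((enumerateBy x hx).trans (enumerateBy y hy).symm) j ↔
      y (enumerateBy x hx i) < y (enumerateBy x hx j) := by
  rw [← enumerateBy_lt_iff y hy]
  simp

theorem isPattern_permOfPoints {α β γ : Type} [Fintype α] [LinearOrder β] [LinearOrder γ]
    {x : α → β} {y : α → γ} (hx : Function.Injective x) (hy : Function.Injective y)
    {n : ℕ} {σ : Equiv.Perm (Fin n)} (F : α → Fin n) (hFx : ∀ a b, x a < x b → F a < F b)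
    (hFy : ∀ a b, y a < y b → σ (F a) < σ (F b)) :
    IsPattern (permOfPoints x y hx hy) ⟨n, σ⟩ := by
  refine ⟨fun i => F (enumerateBy x hx i), fun i j hij => ?_, fun i j => ?_⟩
  · exact hFx _ _ ((enumerateBy_lt_iff x hx i j).mpr hij)
  · refine (permOfPoints_lt_iff x y hx hy i j).trans ⟨hFy _ _, fun h => ?_⟩
    change σ (F (enumerateBy x hx i)) < σ (F (enumerateBy x hx j)) at h
    rcases lt_trichotomy (y (enumerateBy x hx i)) (y (enumerateBy x hx j)) with h' | h' | h'
    · exact h'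
    · rw [hy h'] at h
      exact absurd h (lt_irrefl _)
    · exact absurd (h.trans (hFy _ _ h')) (lt_irrefl _)

theorem IsPattern.refl (σ : FinPerm) : IsPattern σ σ :=
  ⟨id, strictMono_id, fun _ _ => Iff.rfl⟩

theorem blockCoord_lt_iff {α β : Type} [LinearOrder β] {f : α → β} {m : α → ℕ}
    {g : ∀ a, Fin (m a) → Fin (m a)} {p q : Σ a, Fin (m a)} :
    blockCoord f g p < blockCoord f g q ↔
      f p.1 < f q.1 ∨ f p.1 = f q.1 ∧ (g p.1 p.2 : ℕ) < g q.1 q.2 :=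
  Prod.Lex.toLex_lt_toLex

/-- A placement of the points of an inflated expansion into a grid is monotone in a coordinate if
the new points are placed in the right strips. -/
theorem lt_of_blockCoord_lt {k r n : ℕ} {ρ : Equiv.Perm (Fin k)} {f : Fin k → Fin n}
    (hf : ∀ a b, ρ a < ρ b → f a < f b) {c : Fin r → Fin (k + 1)} (hc : Function.Injective c)
    {m : Fin k ⊕ Fin r → ℕ} (hm : ∀ j, m (Sum.inl j) = 1) (g : ∀ a, Fin (m a) → Fin (m a))
    (F : (Σ a, Fin (m a)) → Fin n) (hl : ∀ j z, F ⟨Sum.inl j, z⟩ = f j)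
    (hr : ∀ t z j, F ⟨Sum.inr t, z⟩ ≠ f j) (hgrid : ∀ t z, gridIndex f (F ⟨Sum.inr t, z⟩) = c t)
    (hg : ∀ t z z', g (Sum.inr t) z < g (Sum.inr t) z' →
      F ⟨Sum.inr t, z⟩ < F ⟨Sum.inr t, z'⟩) (p q : Σ a, Fin (m a))
    (h : blockCoord (Sum.elim (fun j => 2 * (ρ j : ℕ) + 1) fun t => 2 * (c t : ℕ)) g p <
      blockCoord (Sum.elim (fun j => 2 * (ρ j : ℕ) + 1) fun t => 2 * (c t : ℕ)) g q) :
    F p < F q := by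
  rw [blockCoord_lt_iff] at h
  obtain ⟨a | t, z⟩ := p <;> obtain ⟨b | u, w⟩ := q <;>
    simp only [Sum.elim_inl, Sum.elim_inr] at h
  · rw [hl, hl]
    rcases h with h | ⟨_, h⟩
    · exact hf a b (Fin.lt_def.mpr (by omega))
    · have h1 := (g _ w).isLt
      have h2 := hm b
      omega
  · rw [hl]
    by_contra hlt
    have h1 := gridIndex_le_of_lt hf (lt_of_le_of_ne (not_lt.mp hlt) (hr u w a))
    rw [hgrid] at h1
    omega
  · rw [hl]
    by_contra hlt
    have h1 := lt_gridIndex_of_lt hf (lt_of_le_of_ne (not_lt.mp hlt) (hr t z b).symm)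
    rw [hgrid] at h1
    omega
  · rcases h with h | ⟨h, h'⟩
    · by_contra hlt
      have h1 := gridIndex_mono f (not_lt.mp hlt)
      rw [hgrid, hgrid, Fin.le_def] at h1
      omega
    · obtain rfl := hc (Fin.ext (by omega : (c t : ℕ) = c u))
      exact hg _ _ _ h'

/-- The placement of the points of an inflated expansion given by an occurrence of `π` and by
a placement of the blocks. -/
def placeBlocks {k r n : ℕ} {Θ : Fin r → FinPerm} (s : Fin k → Fin n)
    (e : ∀ t, Fin (Θ t).1 → Fin n) :
    (Σ a : Fin k ⊕ Fin r, Fin (Sum.elim (fun _ => (⟨1, 1⟩ : FinPerm)) Θ a).1) → Fin n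
  | ⟨Sum.inl j, _⟩ => s j
  | ⟨Sum.inr t, z⟩ => e t z

/-- Distinct blocks lie in distinct columns and distinct rows, so the strips settle all comparisons
except those inside a block. Both coordinates are instances of `lt_of_blockCoord_lt`, with `ρ = 1`
and `ρ = π`. -/
theorem isPattern_expansionInflation {k r n : ℕ} {π : Equiv.Perm (Fin k)} {σ : Equiv.Perm (Fin n)}
    {s : Fin k → Fin n} (h : IsOccurrence π σ s) (i : Fin r ↪ Fin (k + 1)) (Θ : Fin r → FinPerm)
    (e : ∀ t, Fin (Θ t).1 → Fin n) (he : ∀ t, StrictMono (e t))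
    (hv : ∀ t z z', (Θ t).2 z < (Θ t).2 z' → σ (e t z) < σ (e t z'))
    (hs : ∀ t z j, e t z ≠ s j)
    (hrow : ∀ t z, gridIndex (fun j => σ (s j)) (σ (e t z)) =
      i ((finRotate r).symm (Tuple.sort i t)))
    (hcol : ∀ t z, gridIndex s (e t z) = i (Tuple.sort i t)) :
    IsPattern (expansionInflation π i Θ) ⟨n, σ⟩ := by
  refine isPattern_permOfPoints _ _ (placeBlocks s e) (fun p q hpq => ?_) fun p q hpq => ?_
  · exact lt_of_blockCoord_lt (ρ := 1) (f := s) (fun a b hab => h.strictMono hab)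
      (c := fun t => i (Tuple.sort i t)) (i.injective.comp (Tuple.sort i).injective)
      (fun _ => rfl) (fun a => id) (placeBlocks s e) (fun _ _ => rfl) hs hcol
      (fun t z z' hz => he t hz) p q hpq
  · exact lt_of_blockCoord_lt (ρ := π) (f := fun j => σ (s j)) (fun a b hab => (h.lt_iff a b).mp hab)
      (c := fun t => i ((finRotate r).symm (Tuple.sort i t)))
      (i.injective.comp ((finRotate r).symm.injective.comp (Tuple.sort i).injective))
      (fun _ => rfl) (fun a => ⇑(Sum.elim (fun _ => (⟨1, 1⟩ : FinPerm)) Θ a).2)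
      (fun p => σ (placeBlocks s e p)) (fun _ _ => rfl)
      (fun t z j hj => hs t z j (σ.injective hj)) hrow (fun t z z' hz => hv t z z' hz) p q hpq

/-! ### Classes avoiding the expansions have bounded cell matrices -/

/-- The class of increasing permutations or the class of decreasing permutations. -/
def monotoneClass (b : Bool) : Set FinPerm := if b then increasingClass else decreasingClass

theorem monotoneClass_eq (b : Bool) :
    monotoneClass b = increasingClass ∨ monotoneClass b = decreasingClass := by
  cases b
  · exact Or.inr rfl
  · exact Or.inl rfl

/-- The direction `d` depends on the cell alone and is fixed before `θ`, so the permutation to be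
embedded may be chosen after the directions of all cells are known. -/
theorem exists_monotone_of_le_cellMatrix {k n : ℕ} (σ : Equiv.Perm (Fin n)) (s : Fin k → Fin n)
    (a b : Fin (k + 1)) (N : ℕ) (h : 2 ^ (N + N) ≤ cellMatrix σ s a b) :
    ∃ d : Bool, ∀ θ ∈ monotoneClass d, θ.1 ≤ N → ∃ e : Fin θ.1 → Fin n, StrictMono e ∧
      (∀ z z', θ.2 z < θ.2 z' → σ (e z) < σ (e z')) ∧
      ∀ z, (∀ j, e z ≠ s j) ∧ gridIndex (fun j => σ (s j)) (σ (e z)) = a ∧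
        gridIndex s (e z) = b := by
  rcases exists_monotone_subset σ N N (Finset.univ.filter fun p : Fin n =>
      (∀ t, p ≠ s t) ∧ gridIndex (fun t => σ (s t)) (σ p) = a ∧ gridIndex s p = b) h with ⟨T, hT, hc, hm⟩ | ⟨T, hT, hc, hm⟩
  · refine ⟨true, fun θ hθ hN => ⟨fun z => T.orderEmbOfFin hc (Fin.castLE hN z), ?_, ?_, ?_⟩⟩
    · exact fun z z' hz => (T.orderEmbOfFin hc).strictMono hz
    · intro z z' hz
      have hz' : z < z' := (StrictMono.lt_iff_lt hθ).mp hz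
      exact hm _ (T.orderEmbOfFin_mem hc _) _ (T.orderEmbOfFin_mem hc _)
        ((T.orderEmbOfFin hc).strictMono hz')
    · exact fun z => (Finset.mem_filter.mp (hT (T.orderEmbOfFin_mem hc (Fin.castLE hN z)))).2
  · refine ⟨false, fun θ hθ hN => ⟨fun z => T.orderEmbOfFin hc (Fin.castLE hN z), ?_, ?_, ?_⟩⟩
    · exact fun z z' hz => (T.orderEmbOfFin hc).strictMono hz
    · intro z z' hz
      have hz' : z' < z := (StrictAnti.lt_iff_gt hθ).mp hz
      exact hm _ (T.orderEmbOfFin_mem hc _) _ (T.orderEmbOfFin_mem hc _)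
        ((T.orderEmbOfFin hc).strictMono hz')
    · exact fun z => (Finset.mem_filter.mp (hT (T.orderEmbOfFin_mem hc (Fin.castLE hN z)))).2

theorem exists_bound_offDiagSum {k : ℕ} {π : Equiv.Perm (Fin k)} {C : Set FinPerm}
    (hC : IsPermClass C)
    (hav : ∀ (r : ℕ), 2 ≤ r → ∀ (i : Fin r ↪ Fin (k + 1)) (X : Fin r → Set FinPerm),
      (∀ t, X t = increasingClass ∨ X t = decreasingClass) → ∃ τ ∈ expansionClass π i X, τ ∉ C) :
    ∃ M : ℕ, 0 < M ∧ ∀ (n : ℕ) (σ : Equiv.Perm (Fin n)), ⟨n, σ⟩ ∈ C →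
      ∀ s : Fin k → Fin n, IsStableOccurrence π σ s → offDiagSum (cellMatrix σ s) ≤ M := by
  -- Since `r ≤ k + 1`, cycles with directions form a finite type, so one `N` bounds the sizes of
  -- all chosen witnesses. For `r < 2` the witness is a dummy.
  have hΘ : ∀ ω : Σ r : Fin (k + 2), (Fin r ↪ Fin (k + 1)) × (Fin r → Bool),
      ∃ Θ : Fin ω.1 → FinPerm, 2 ≤ (ω.1 : ℕ) → (∀ t, Θ t ∈ monotoneClass (ω.2.2 t)) ∧
        expansionInflation π ω.2.1 Θ ∉ C := by
    rintro ⟨r, i, d⟩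
    by_cases hr : 2 ≤ (r : ℕ)
    · obtain ⟨τ, ⟨Θ, hΘ, hτ⟩, hτC⟩ := hav r hr i (fun t => monotoneClass (d t))
        fun t => monotoneClass_eq _
      exact ⟨Θ, fun _ => ⟨hΘ, fun hE => hτC (hC _ hE _ hτ)⟩⟩
    · exact ⟨fun _ => ⟨0, 1⟩, fun h => absurd h hr⟩
  choose Θ hΘ using hΘ
  set N := Finset.univ.sup fun ω => Finset.univ.sup fun t => (Θ ω t).1 with hN
  have hle : ∀ ω t, (Θ ω t).1 ≤ N := fun ω t =>
    (Finset.le_sup (f := fun t => (Θ ω t).1) (Finset.mem_univ t)).trans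
      (Finset.le_sup (f := fun ω => Finset.univ.sup fun t => (Θ ω t).1) (Finset.mem_univ ω))
  -- The bound is the threshold of `exists_cycle_of_isBalanced` for entries at least `2 ^ (N + N)`,
  -- plus one to make it positive.
  refine ⟨_, Nat.succ_pos (Fintype.card (Fin (k + 1)) *
    (Fintype.card (Fin (k + 1)) ^ (2 * Fintype.card (Fin (k + 1)) + 1) * 2 ^ (N + N))),
    fun n σ hσ s hs => ?_⟩
  by_contra! hlt
  obtain ⟨r, hr, i, hi⟩ := exists_cycle_of_isBalanced (B := offDiag (cellMatrix σ s))
    (isBalanced_offDiag_iff.mpr hs.isBalanced) (fun v => if_pos rfl)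
    ((Nat.lt_succ_self _).trans hlt)
  have hentry : ∀ t, 2 ^ (N + N) ≤
      cellMatrix σ s (i ((finRotate r).symm (Tuple.sort i t))) (i (Tuple.sort i t)) := by
    intro t
    have h1 := hi ((finRotate r).symm (Tuple.sort i t))
    rw [Equiv.apply_symm_apply] at h1
    refine h1.trans ?_
    unfold offDiag
    split_ifs
    · exact Nat.zero_le _
    · exact le_rfl
  choose d hd using fun t => exists_monotone_of_le_cellMatrix σ s _ _ N (hentry t)
  have hrk : r ≤ k + 1 := by simpa using Fintype.card_le_of_embedding i
  obtain ⟨hmono, hnot⟩ := hΘ ⟨⟨r, Nat.lt_succ_of_le hrk⟩, i, d⟩ hr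
  choose e he hv hcell using fun t => hd t _ (hmono t)
    (hle ⟨⟨r, Nat.lt_succ_of_le hrk⟩, i, d⟩ t)
  exact hnot (hC _ hσ _ (isPattern_expansionInflation hs.toIsOccurrence i _ e he hv
    (fun t z => (hcell t z).1) (fun t z => (hcell t z).2.1) fun t z => (hcell t z).2.2))

/-! ### Ehrenfeucht–Fraïssé games for two orders -/

/-- Pairs of corresponding elements agree on all atomic formulas. -/
def AtomicallyEquivalent {n n' : ℕ} (σ : Equiv.Perm (Fin n)) (σ' : Equiv.Perm (Fin n'))
    (S : Set (Fin n × Fin n')) : Prop :=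
  ∀ p ∈ S, ∀ q ∈ S, (p.1 = q.1 ↔ p.2 = q.2) ∧ (p.1 < q.1 ↔ p.2 < q.2) ∧
    (σ p.1 < σ q.1 ↔ σ' p.2 < σ' q.2)

/-- The second player wins the Ehrenfeucht–Fraïssé game with `q` rounds left, the pairs of elements
in `S` having been chosen so far. -/
def GameEquivalent {n n' : ℕ} (σ : Equiv.Perm (Fin n)) (σ' : Equiv.Perm (Fin n')) :
    ℕ → Set (Fin n × Fin n') → Prop
  | 0, S => AtomicallyEquivalent σ σ' S
  | q + 1, S => GameEquivalent σ σ' q S ∧ (∀ p, ∃ p', GameEquivalent σ σ' q (insert (p, p') S)) ∧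
      ∀ p', ∃ p, GameEquivalent σ σ' q (insert (p, p') S)

/-- This is the purpose of the first conjunct in `GameEquivalent`: an implication needs the larger
of the two numbers of rounds of its parts. -/
theorem GameEquivalent.of_le {n n' : ℕ} {σ : Equiv.Perm (Fin n)} {σ' : Equiv.Perm (Fin n')}
    {q q' : ℕ} (h : q ≤ q') {S : Set (Fin n × Fin n')} (hS : GameEquivalent σ σ' q' S) :
    GameEquivalent σ σ' q S := by
  induction h with
  | refl => exact hS
  | step _ ih => exact ih hS.1

theorem GameEquivalent.atomicallyEquivalent {n n' : ℕ} {σ : Equiv.Perm (Fin n)}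
    {σ' : Equiv.Perm (Fin n')} {q : ℕ} {S : Set (Fin n × Fin n')}
    (hS : GameEquivalent σ σ' q S) : AtomicallyEquivalent σ σ' S :=
  hS.of_le (Nat.zero_le q)

theorem exists_realize_eq_var {α : Type} {l : ℕ} (t : toto.Term (α ⊕ Fin l)) :
    ∃ x, t = FirstOrder.Language.Term.var x := by
  cases t with
  | var x => exact ⟨x, rfl⟩
  | func f _ => exact nomatch f

/-- Formulas do not distinguish tuples from which the second player wins all long enough games. -/
theorem exists_realize_iff_of_gameEquivalent {α : Type} {l : ℕ}
    (φ : toto.BoundedFormula α l) : ∃ q, ∀ (n n' : ℕ) (σ : Equiv.Perm (Fin n))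
      (σ' : Equiv.Perm (Fin n')) (S : Set (Fin n × Fin n')), GameEquivalent σ σ' q S →
      ∀ (v : α → Fin n) (v' : α → Fin n') (xs : Fin l → Fin n) (xs' : Fin l → Fin n'),
      (∀ a, (v a, v' a) ∈ S) → (∀ j, (xs j, xs' j) ∈ S) →
      ((letI := totoStructure σ; φ.Realize v xs) ↔
        (letI := totoStructure σ'; φ.Realize v' xs')) := by
  induction φ with
  | falsum => exact ⟨0, fun _ _ _ _ _ _ _ _ _ _ _ _ => Iff.rfl⟩
  | @equal l t₁ t₂ =>
    obtain ⟨x₁, rfl⟩ := exists_realize_eq_var t₁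
    obtain ⟨x₂, rfl⟩ := exists_realize_eq_var t₂
    refine ⟨0, fun n n' σ σ' S hS v v' xs xs' hv hxs => ?_⟩
    have hmem : ∀ x : α ⊕ Fin l, (Sum.elim v xs x, Sum.elim v' xs' x) ∈ S := by
      rintro (a | j)
      exacts [hv a, hxs j]
    exact (hS _ (hmem x₁) _ (hmem x₂)).1
  | @rel l m R ts =>
    choose x hx using fun j => exists_realize_eq_var (ts j)
    obtain rfl : ts = fun j => FirstOrder.Language.Term.var (x j) := funext hx
    refine ⟨0, fun n n' σ σ' S hS v v' xs xs' hv hxs => ?_⟩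
    have hmem : ∀ x : α ⊕ Fin l, (Sum.elim v xs x, Sum.elim v' xs' x) ∈ S := by
      rintro (a | j)
      exacts [hv a, hxs j]
    cases R with
    | ltP => exact (hS _ (hmem (x 0)) _ (hmem (x 1))).2.1
    | ltV => exact (hS _ (hmem (x 0)) _ (hmem (x 1))).2.2
  | imp φ ψ ih₁ ih₂ =>
    obtain ⟨q₁, h₁⟩ := ih₁
    obtain ⟨q₂, h₂⟩ := ih₂
    refine ⟨max q₁ q₂, fun n n' σ σ' S hS v v' xs xs' hv hxs => ?_⟩
    exact imp_congr (h₁ n n' σ σ' S (hS.of_le (le_max_left _ _)) v v' xs xs' hv hxs)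
      (h₂ n n' σ σ' S (hS.of_le (le_max_right _ _)) v v' xs xs' hv hxs)
  | @all l φ ih =>
    obtain ⟨q, h⟩ := ih
    refine ⟨q + 1, fun n n' σ σ' S hS v v' xs xs' hv hxs => ?_⟩
    -- Each quantifier costs one round: the new value of the bound variable is a move, answered in
    -- the other permutation.
    have hext : ∀ p p', GameEquivalent σ σ' q (insert (p, p') S) →
        ((letI := totoStructure σ; φ.Realize v (Fin.snoc xs p : Fin (l + 1) → Fin n)) ↔
          (letI := totoStructure σ'; φ.Realize v' (Fin.snoc xs' p' : Fin (l + 1) → Fin n'))) := by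
      intro p p' hp
      refine h n n' σ σ' _ hp v v' _ _ (fun a => Set.mem_insert_of_mem _ (hv a)) fun j => ?_
      refine Fin.lastCases ?_ (fun j => ?_) j
      · simp only [Fin.snoc_last]
        exact Set.mem_insert _ _
      · simp only [Fin.snoc_castSucc]
        exact Set.mem_insert_of_mem _ (hxs j)
    constructor
    · intro hall p'
      obtain ⟨p, hp⟩ := hS.2.2 p'
      exact (hext p p' hp).mp (hall p)
    · intro hall p
      obtain ⟨p', hp⟩ := hS.2.1 p
      exact (hext p p' hp).mpr (hall p')

/-! ### The game on linear orders -/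

/-- Differences of corresponding coordinates are equal, or both large with the same sign. -/
def CloseUpTo (Q : ℤ) (u w : ℤ × ℤ) : Prop :=
  u.1 - w.1 = u.2 - w.2 ∨ (Q ≤ u.1 - w.1 ∧ Q ≤ u.2 - w.2) ∨ (Q ≤ w.1 - u.1 ∧ Q ≤ w.2 - u.2)

theorem CloseUpTo.symm {Q : ℤ} {u w : ℤ × ℤ} (h : CloseUpTo Q u w) : CloseUpTo Q w u := by
  unfold CloseUpTo at *
  omega

theorem CloseUpTo.mono {Q Q' : ℤ} (hQ : Q ≤ Q') {u w : ℤ × ℤ} (h : CloseUpTo Q' u w) :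
    CloseUpTo Q u w := by
  unfold CloseUpTo at *
  omega

theorem CloseUpTo.swap {Q : ℤ} {u w : ℤ × ℤ} (h : CloseUpTo Q u w) :
    CloseUpTo Q u.swap w.swap := by
  simp only [CloseUpTo, Prod.fst_swap, Prod.snd_swap] at *
  omega

theorem CloseUpTo.lt_iff {Q : ℤ} (hQ : 0 < Q) {u w : ℤ × ℤ} (h : CloseUpTo Q u w) :
    u.1 < w.1 ↔ u.2 < w.2 := by
  unfold CloseUpTo at h
  omega

/-- The response of the second player in the game on linear orders. -/
theorem exists_response {Q : ℤ} (hQ : 0 < Q) {T : Set (ℤ × ℤ)}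
    (hT : ∀ u ∈ T, ∀ w ∈ T, CloseUpTo (2 * Q) u w) {L L' : ℤ} (h0 : (0, 0) ∈ T)
    (h1 : (L, L') ∈ T) {c : ℤ} (hc : 0 < c) (hcL : c < L) :
    ∃ c', 0 < c' ∧ c' < L' ∧ ∀ u ∈ T, CloseUpTo Q (c, c') u := by
  suffices h : ∃ c', ∀ u ∈ T, CloseUpTo Q (c, c') u by
    obtain ⟨c', hc'⟩ := h
    exact ⟨c', ((hc' _ h0).symm.lt_iff hQ).mp hc, ((hc' _ h1).lt_iff hQ).mp hcL, hc'⟩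
  -- The marked points `l ≤ c < h` nearest to `c` exist because both end points of the order are
  -- marked.
  obtain ⟨l, ⟨hlc, l', hl⟩, hlmax⟩ := Int.exists_greatest_of_bdd
    (P := fun z => z ≤ c ∧ ∃ z', (z, z') ∈ T) ⟨c, fun z hz => hz.1⟩ ⟨0, hc.le, 0, h0⟩
  obtain ⟨h, ⟨hch, h', hh⟩, hhmin⟩ := Int.exists_least_of_bdd
    (P := fun z => c < z ∧ ∃ z', (z, z') ∈ T) ⟨c, fun z hz => hz.1.le⟩ ⟨L, hcL, L', h1⟩
  have hsplit : ∀ u ∈ T, u.1 ≤ l ∨ h ≤ u.1 := fun u hu => by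
    rcases le_or_gt u.1 c with huc | huc
    · exact Or.inl (hlmax u.1 ⟨huc, u.2, hu⟩)
    · exact Or.inr (hhmin u.1 ⟨huc, u.2, hu⟩)
  have hlh := hT _ hl _ hh
  -- If `c` is within `Q` of a neighbour, its offset is copied. Otherwise `h - l ≥ 2 * Q`, hence
  -- also `h' - l' ≥ 2 * Q`, and `l' + Q` is at least `Q` away from both `l'` and `h'`.
  by_cases h1 : c - l < Q
  · refine ⟨l' + (c - l), fun u hu => ?_⟩
    have h2 := hT _ hl _ hu
    simp only [CloseUpTo] at *
    omega
  by_cases h2 : h - c < Q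
  · refine ⟨h' - (h - c), fun u hu => ?_⟩
    have h2 := hT _ hh _ hu
    simp only [CloseUpTo] at *
    omega
  refine ⟨l' + Q, fun u hu => ?_⟩
  have h3 := hT _ hl _ hu
  have h4 := hT _ hh _ hu
  have h5 := hsplit u hu
  simp only [CloseUpTo] at *
  omega

/-! ### The game on permutations made of monotone blocks -/

/-- A decomposition of the points of a permutation into blocks, indexed by `A` and ordered by the
injective coordinates `X` and `Y`, such that the block `a` has `size a` points and is increasing or
decreasing according to `dir a`. -/
structure BlockDecomposition {A : Type} (X Y : A → ℕ) (dir : A → Bool) (size : A → ℕ) {n : ℕ}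
    (σ : Equiv.Perm (Fin n)) where
  block : Fin n → A
  coord : Fin n → ℤ
  coord_pos : ∀ p, 0 < coord p
  coord_lt : ∀ p, coord p < size (block p) + 1
  exists_coord : ∀ a (c : ℤ), 0 < c → c < size a + 1 → ∃ p, block p = a ∧ coord p = c
  eq_iff : ∀ p q, p = q ↔ block p = block q ∧ coord p = coord q
  lt_iff : ∀ p q, p < q ↔
    X (block p) < X (block q) ∨ block p = block q ∧ coord p < coord q
  apply_lt_iff : ∀ p q, σ p < σ q ↔ Y (block p) < Y (block q) ∨
    block p = block q ∧ if dir (block p) then coord p < coord q else coord q < coord p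

section BlockGame

variable {A : Type} {X Y : A → ℕ} {dir : A → Bool} {size size' : A → ℕ} {n n' : ℕ}
  {σ : Equiv.Perm (Fin n)} {σ' : Equiv.Perm (Fin n')} (D : BlockDecomposition X Y dir size σ)
  (D' : BlockDecomposition X Y dir size' σ')

/-- The pairs of coordinates of the pairs in `S` in the block `a`, with the end points added. -/
def blockPairs (S : Set (Fin n × Fin n')) (a : A) : Set (ℤ × ℤ) :=
  {u | u = (0, 0) ∨ u = ((size a : ℤ) + 1, (size' a : ℤ) + 1) ∨
    ∃ p ∈ S, D.block p.1 = a ∧ u = (D.coord p.1, D'.coord p.2)}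

/-- A winning position for the second player with `q` rounds left. -/
def IsWinning (q : ℕ) (S : Set (Fin n × Fin n')) : Prop :=
  (∀ p ∈ S, D.block p.1 = D'.block p.2) ∧ ∀ a, ∀ u ∈ blockPairs D D' S a,
    ∀ w ∈ blockPairs D D' S a, CloseUpTo (2 ^ q) u w

variable {D D'}

theorem IsWinning.atomicallyEquivalent {q : ℕ} {S : Set (Fin n × Fin n')}
    (h : IsWinning D D' q S) : AtomicallyEquivalent σ σ' S := by
  have key : ∀ p ∈ S, ∀ q ∈ S, D.block p.1 = D.block q.1 →
      (D.coord p.1 < D.coord q.1 ↔ D'.coord p.2 < D'.coord q.2) := fun p hp q hq hpq =>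
    CloseUpTo.lt_iff (by positivity) (h.2 (D.block q.1) (D.coord p.1, D'.coord p.2)
      (Or.inr (Or.inr ⟨p, hp, hpq, rfl⟩)) (D.coord q.1, D'.coord q.2)
      (Or.inr (Or.inr ⟨q, hq, rfl, rfl⟩)))
  intro p hp q hq
  rw [D.eq_iff, D'.eq_iff, D.lt_iff, D'.lt_iff, D.apply_lt_iff, D'.apply_lt_iff,
    ← h.1 p hp, ← h.1 q hq]
  refine ⟨and_congr_right fun hb => ?_, or_congr Iff.rfl (and_congr_right fun hb => ?_),
    or_congr Iff.rfl (and_congr_right fun hb => ?_)⟩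
  · have h1 := key p hp q hq hb
    have h2 := key q hq p hp hb.symm
    omega
  · exact key p hp q hq hb
  · split_ifs
    · exact key p hp q hq hb
    · exact key q hq p hp hb.symm

/-- Only the block of `p` acquires a new pair; the old pairs merely lose half of their tolerance. -/
theorem IsWinning.insert_pair {q : ℕ} {S : Set (Fin n × Fin n')} (h : IsWinning D D' (q + 1) S)
    {p : Fin n} {p' : Fin n'} (hb : D.block p = D'.block p')
    (hc : ∀ u ∈ blockPairs D D' S (D.block p), CloseUpTo (2 ^ q) (D.coord p, D'.coord p') u) :
    IsWinning D D' q (insert (p, p') S) := by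
  have hmem : ∀ a, ∀ u ∈ blockPairs D D' (insert (p, p') S) a,
      u ∈ blockPairs D D' S a ∨ D.block p = a ∧ u = (D.coord p, D'.coord p') := by
    rintro a u (hu | hu | ⟨w, hw | hw, hwa, hu⟩)
    · exact Or.inl (Or.inl hu)
    · exact Or.inl (Or.inr (Or.inl hu))
    · subst hw
      exact Or.inr ⟨hwa, hu⟩
    · exact Or.inl (Or.inr (Or.inr ⟨w, hw, hwa, hu⟩))
  refine ⟨?_, fun a u hu w hw => ?_⟩
  · rintro w (rfl | hw)
    exacts [hb, h.1 w hw]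
  · rcases hmem a u hu with hu | ⟨rfl, rfl⟩ <;> rcases hmem _ w hw with hw | ⟨hwa, rfl⟩
    · exact (h.2 a u hu w hw).mono (pow_le_pow_right₀ (by norm_num) (Nat.le_succ q))
    · subst hwa
      exact (hc u hu).symm
    · exact hc w hw
    · exact Or.inl (by ring)

theorem IsWinning.of_succ {q : ℕ} {S : Set (Fin n × Fin n')} (h : IsWinning D D' (q + 1) S) :
    IsWinning D D' q S :=
  ⟨h.1, fun a u hu w hw =>
    (h.2 a u hu w hw).mono (pow_le_pow_right₀ (by norm_num) (Nat.le_succ q))⟩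

/-- The second player answers within the block of the same name, playing the game on linear orders
there. The order of the blocks settles comparisons between different blocks. -/
theorem IsWinning.gameEquivalent {q : ℕ} {S : Set (Fin n × Fin n')}
    (h : IsWinning D D' q S) : GameEquivalent σ σ' q S := by
  induction q generalizing S with
  | zero => exact h.atomicallyEquivalent
  | succ q ih =>
    have hpow : (2 : ℤ) ^ (q + 1) = 2 * 2 ^ q := by ring
    refine ⟨ih h.of_succ, fun p => ?_, fun p' => ?_⟩
    · obtain ⟨c', hc0, hc1, hc'⟩ := exists_response (Q := 2 ^ q) (by positivity)
        (T := blockPairs D D' S (D.block p)) (fun u hu w hw => hpow ▸ h.2 _ u hu w hw)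
        (Or.inl rfl) (Or.inr (Or.inl rfl)) (D.coord_pos p) (D.coord_lt p)
      obtain ⟨p', hb, rfl⟩ := D'.exists_coord _ c' hc0 hc1
      exact ⟨p', ih (h.insert_pair hb.symm hc')⟩
    -- A move in the second permutation is the same game with the two sides exchanged.
    · obtain ⟨c, hc0, hc1, hc⟩ := exists_response (Q := 2 ^ q) (by positivity)
        (T := Prod.swap ⁻¹' blockPairs D D' S (D'.block p'))
        (fun u hu w hw => (hpow ▸ h.2 _ u.swap hu w.swap hw : CloseUpTo _ u.swap w.swap).swap)
        (Or.inl rfl) (Or.inr (Or.inl rfl)) (D'.coord_pos p') (D'.coord_lt p')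
      obtain ⟨p, hb, rfl⟩ := D.exists_coord _ c hc0 hc1
      exact ⟨p, ih (h.insert_pair hb fun u hu => (hc u.swap (by rwa [hb] at hu)).swap)⟩

end BlockGame

/-! ### Counting points in block decompositions -/

section Counting

variable {A : Type} {X Y : A → ℕ} {dir : A → Bool} {size : A → ℕ} {n : ℕ}
  {σ : Equiv.Perm (Fin n)}

theorem BlockDecomposition.card_block [DecidableEq A] (D : BlockDecomposition X Y dir size σ)
    (a : A) : (Finset.univ.filter fun p => D.block p = a).card = size a := by
  have h : (Finset.univ.filter fun p => D.block p = a).image D.coord =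
      Finset.Ioo (0 : ℤ) (size a + 1) := by
    ext c
    simp only [Finset.mem_image, Finset.mem_filter, Finset.mem_univ, true_and, Finset.mem_Ioo]
    constructor
    · rintro ⟨p, rfl, rfl⟩
      exact ⟨D.coord_pos p, D.coord_lt p⟩
    · rintro ⟨h0, h1⟩
      exact D.exists_coord a c h0 h1
  have hinj : Set.InjOn D.coord (Finset.univ.filter fun p => D.block p = a : Finset (Fin n)) := by
    intro p hp q hq hpq
    simp only [Finset.coe_filter, Finset.mem_univ, true_and, Set.mem_ofPred_eq] at hp hq
    exact (D.eq_iff p q).mpr ⟨hp.trans hq.symm, hpq⟩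
  rw [← Finset.card_image_of_injOn hinj, h, Int.card_Ioo]
  omega

theorem BlockDecomposition.card_filter_block [Fintype A] (D : BlockDecomposition X Y dir size σ)
    (P : A → Prop) [DecidablePred P] :
    (Finset.univ.filter fun p => P (D.block p)).card = ∑ a, if P a then size a else 0 := by
  classical
  rw [Finset.card_eq_sum_card_fiberwise (f := D.block) (t := Finset.univ)
    (fun _ _ => Finset.mem_coe.mpr (Finset.mem_univ _))]
  refine Finset.sum_congr rfl fun a _ => ?_
  rw [Finset.filter_filter]
  split_ifs with h
  · rw [← D.card_block a]
    congr 1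
    ext p
    simp only [Finset.mem_filter, Finset.mem_univ, true_and]
    exact ⟨fun hp => hp.2, fun hp => ⟨hp ▸ h, hp⟩⟩
  · rw [Finset.card_eq_zero, Finset.filter_eq_empty_iff]
    rintro p - ⟨hp, rfl⟩
    exact h hp

theorem BlockDecomposition.coord_eq_one (D : BlockDecomposition X Y dir size σ) {p : Fin n}
    (hp : size (D.block p) = 1) : D.coord p = 1 := by
  have h0 := D.coord_pos p
  have h1 := D.coord_lt p
  rw [hp] at h1
  push_cast at h1
  omega

theorem BlockDecomposition.val_eq_sum [Fintype A] (D : BlockDecomposition X Y dir size σ)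
    {p : Fin n} (hp : size (D.block p) = 1) :
    (p : ℕ) = ∑ a, if X a < X (D.block p) then size a else 0 := by
  rw [← D.card_filter_block fun a => X a < X (D.block p),
    ← card_filter_perm_lt (1 : Equiv.Perm (Fin n)) p p.isLt.le]
  congr 1
  ext q
  simp only [Finset.mem_filter, Finset.mem_univ, true_and, Equiv.Perm.one_apply, Fin.val_fin_lt]
  rw [D.lt_iff, or_iff_left]
  rintro ⟨hb, hc⟩
  rw [D.coord_eq_one hp, D.coord_eq_one (hb ▸ hp)] at hc
  exact lt_irrefl _ hc

theorem BlockDecomposition.apply_val_eq_sum [Fintype A] (D : BlockDecomposition X Y dir size σ)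
    {p : Fin n} (hp : size (D.block p) = 1) :
    (σ p : ℕ) = ∑ a, if Y a < Y (D.block p) then size a else 0 := by
  rw [← D.card_filter_block fun a => Y a < Y (D.block p),
    ← card_filter_perm_lt σ (σ p) (σ p).isLt.le]
  congr 1
  ext q
  simp only [Finset.mem_filter, Finset.mem_univ, true_and, Fin.val_fin_lt]
  rw [D.apply_lt_iff, or_iff_left]
  rintro ⟨hb, hc⟩
  rw [D.coord_eq_one hp, D.coord_eq_one (hb ▸ hp)] at hc
  split_ifs at hc <;> exact lt_irrefl _ hc

end Counting

/-! ### Inflations by monotone permutations -/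

/-- The increasing or decreasing permutation of `Fin N`. -/
def monotoneEquiv (b : Bool) (N : ℕ) : Equiv.Perm (Fin N) :=
  match b with
  | true => 1
  | false => Fin.revPerm

/-- The increasing or decreasing permutation of a given size. -/
def monotonePerm (b : Bool) (N : ℕ) : FinPerm := ⟨N, monotoneEquiv b N⟩

theorem monotonePerm_mem (b : Bool) (N : ℕ) : monotonePerm b N ∈ monotoneClass b := by
  cases b
  · exact Fin.rev_strictAnti
  · exact fun _ _ h => h

theorem monotoneEquiv_lt_iff (b : Bool) (N : ℕ) (z w : Fin N) :
    monotoneEquiv b N z < monotoneEquiv b N w ↔ if b then z < w else w < z := by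
  cases b
  · exact Fin.rev_lt_rev
  · exact Iff.rfl

/-- The decomposition given by a bijection onto the points of an inflation by monotone
permutations. -/
def BlockDecomposition.ofEquiv {A : Type} {X Y : A → ℕ} (hX : Function.Injective X)
    (hY : Function.Injective Y) (dir : A → Bool) (size : A → ℕ) {n : ℕ} (σ : Equiv.Perm (Fin n))
    (e : Fin n ≃ Σ a, Fin (size a))
    (hx : ∀ p q, p < q ↔ blockCoord X (fun _ => id) (e p) < blockCoord X (fun _ => id) (e q))
    (hy : ∀ p q, σ p < σ q ↔ blockCoord Y (fun a => monotoneEquiv (dir a) (size a)) (e p) <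
      blockCoord Y (fun a => monotoneEquiv (dir a) (size a)) (e q)) :
    BlockDecomposition X Y dir size σ where
  block p := (e p).1
  -- Coordinates run from `1` to the size of the block, leaving `0` and `size + 1` free as the
  -- artificial end points in `blockPairs`.
  coord p := ((e p).2 : ℕ) + 1
  coord_pos p := by positivity
  coord_lt p := Int.add_lt_add_right (Int.ofNat_lt.mpr (e p).2.isLt) 1
  exists_coord a c h0 h1 := by
    refine ⟨e.symm ⟨a, ⟨(c - 1).toNat, (by omega : (c - 1).toNat < size a)⟩⟩, ?_⟩
    rw [Equiv.apply_symm_apply]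
    refine ⟨rfl, ?_⟩
    change ((c - 1).toNat : ℤ) + 1 = c
    omega
  eq_iff p q := by
    rw [← e.injective.eq_iff]
    generalize e p = u
    generalize e q = w
    obtain ⟨a, z⟩ := u
    obtain ⟨b, w⟩ := w
    constructor
    · intro h
      cases h
      exact ⟨rfl, rfl⟩
    · rintro ⟨h, h'⟩
      dsimp only at h h'
      subst h
      rw [Fin.ext (by omega : (z : ℕ) = w)]
  lt_iff p q := by
    rw [hx, blockCoord_lt_iff, hX.eq_iff]
    refine or_congr Iff.rfl (and_congr_right fun _ => ?_)
    simp only [id]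
    omega
  apply_lt_iff p q := by
    rw [hy, blockCoord_lt_iff, hY.eq_iff]
    generalize e p = u
    generalize e q = w
    obtain ⟨a, z⟩ := u
    obtain ⟨b, w⟩ := w
    refine or_congr Iff.rfl (and_congr_right fun h => ?_)
    dsimp only at h ⊢
    subst h
    rw [Fin.val_fin_lt, monotoneEquiv_lt_iff]
    split_ifs
    · rw [Fin.lt_def]
      omega
    · rw [Fin.lt_def]
      omega

/-- The blocks of an inflation by monotone permutations. -/
noncomputable def inflateDecomposition {A : Type} [Fintype A] {X Y : A → ℕ}
    (hX : Function.Injective X) (hY : Function.Injective Y) (dir : A → Bool) (size : A → ℕ) :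
    BlockDecomposition X Y dir size
      (inflate X Y hX hY fun a => monotonePerm (dir a) (size a)).2 :=
  BlockDecomposition.ofEquiv hX hY dir size _
    (enumerateBy _ (blockCoord_injective hX fun _ => Function.injective_id))
    (fun p q => (enumerateBy_lt_iff _ (blockCoord_injective hX fun _ => Function.injective_id)
      p q).symm)
    (permOfPoints_lt_iff _ _ (blockCoord_injective hX fun _ => Function.injective_id)
      (blockCoord_injective hY fun a => (monotoneEquiv (dir a) (size a)).injective))

/-- Points of `π` count as increasing blocks of size one, so that every block is monotone and the
block game applies. -/
theorem expansionInflation_monotonePerm {k r : ℕ} (π : Equiv.Perm (Fin k))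
    (i : Fin r ↪ Fin (k + 1)) (d : Fin r → Bool) (N : Fin r → ℕ) :
    expansionInflation π i (fun t => monotonePerm (d t) (N t)) =
      inflate (expansionX i) (expansionY π i) (expansionX_injective i) (expansionY_injective π i)
        fun a => monotonePerm (Sum.elim (fun _ => true) d a) (Sum.elim (fun _ => 1) N a) := by
  unfold expansionInflation
  congr 1
  funext a
  cases a <;> rfl

/-! ### The points of `π` in an inflated expansion -/

section ExpansionOccurrence

variable {k r n : ℕ} {π : Equiv.Perm (Fin k)} {i : Fin r ↪ Fin (k + 1)} {d : Fin r → Bool}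
  {N : Fin r → ℕ} {σ : Equiv.Perm (Fin n)}
  (D : BlockDecomposition (expansionX i) (expansionY π i) (Sum.elim (fun _ => true) d)
    (Sum.elim (fun _ => 1) N) σ) {s : Fin k → Fin n}

theorem isOccurrence_of_block_eq (hs : ∀ j, D.block (s j) = Sum.inl j) : IsOccurrence π σ s where
  strictMono a b hab := by
    rw [D.lt_iff, hs, hs]
    refine Or.inl ?_
    simp only [expansionX, Sum.elim_inl]
    rw [Fin.lt_def] at hab
    omega
  lt_iff a b := by
    rw [D.apply_lt_iff, hs, hs, or_iff_left]
    · simp only [expansionY, Sum.elim_inl]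
      rw [Fin.lt_def]
      omega
    · rintro ⟨hab, hc⟩
      obtain rfl := Sum.inl.inj hab
      split_ifs at hc <;> exact lt_irrefl _ hc

/-- Stability means `σ (s j) = s (π j)`. Both sides count `π j` points of `π`, so what remains is to
compare the new points in rows of index at most `π j` with those in columns of index at most `π j`.
-/
theorem isStableOccurrence_iff_of_block_eq (hs : ∀ j, D.block (s j) = Sum.inl j) : IsStableOccurrence π σ s ↔
    ∀ j : Fin k, (∑ t, if (i ((finRotate r).symm (Tuple.sort i t)) : ℕ) ≤ j then N t else 0) =
      ∑ t, if (i (Tuple.sort i t) : ℕ) ≤ j then N t else 0 := by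
  have hocc := isOccurrence_of_block_eq D hs
  have hx : ∀ j, (s j : ℕ) = (∑ j' : Fin k, if (j' : ℕ) < j then 1 else 0) +
      ∑ t, if (i (Tuple.sort i t) : ℕ) ≤ j then N t else 0 := by
    intro j
    rw [D.val_eq_sum (by rw [hs, Sum.elim_inl]), Fintype.sum_sum_type, hs]
    -- With points at odd and strips at even coordinates, strip `c` precedes point `j` exactly when
    -- `c ≤ j`.
    simp only [expansionX, Sum.elim_inl, Sum.elim_inr]
    congr 1
    · exact Finset.sum_congr rfl fun _ _ => if_congr (by omega) rfl rfl
    · exact Finset.sum_congr rfl fun _ _ => if_congr (by omega) rfl rfl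
  have hy : ∀ j, (σ (s j) : ℕ) = (∑ j' : Fin k, if (j' : ℕ) < π j then 1 else 0) +
      ∑ t, if (i ((finRotate r).symm (Tuple.sort i t)) : ℕ) ≤ π j then N t else 0 := by
    intro j
    rw [D.apply_val_eq_sum (by rw [hs, Sum.elim_inl]), Fintype.sum_sum_type, hs]
    simp only [expansionY, Sum.elim_inl, Sum.elim_inr]
    congr 1
    · rw [← Equiv.sum_comp π fun j' : Fin k => if (j' : ℕ) < π j then 1 else 0]
      exact Finset.sum_congr rfl fun _ _ => if_congr (by omega) rfl rfl
    · exact Finset.sum_congr rfl fun _ _ => if_congr (by omega) rfl rfl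
  have heq : ∀ j, σ (s j) = s (π j) ↔
      (∑ t, if (i ((finRotate r).symm (Tuple.sort i t)) : ℕ) ≤ π j then N t else 0) =
        ∑ t, if (i (Tuple.sort i t) : ℕ) ≤ π j then N t else 0 := by
    intro j
    rw [Fin.ext_iff, hx, hy]
    omega
  constructor
  · intro h j
    have := (heq (π.symm j)).mp (h.apply_eq _)
    rwa [Equiv.apply_symm_apply] at this
  · exact fun h => hocc.isStableOccurrence fun j => (heq j).mpr (h (π j))

end ExpansionOccurrence

/-- Each element of the cycle is once a row and once a column, so equal block sizes give equal sums
after reindexing. -/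
theorem sum_const_rotate_eq {k r : ℕ} (i : Fin r ↪ Fin (k + 1)) (N : ℕ) (j : Fin k) :
    (∑ t, if (i ((finRotate r).symm (Tuple.sort i t)) : ℕ) ≤ j then N else 0) =
      ∑ t, if (i (Tuple.sort i t) : ℕ) ≤ j then N else 0 := by
  rw [Equiv.sum_comp (Tuple.sort i) fun t => if (i ((finRotate r).symm t) : ℕ) ≤ j then N else 0,
    Equiv.sum_comp (Tuple.sort i) fun t => if (i t : ℕ) ≤ j then N else 0,
    Equiv.sum_comp (finRotate r).symm fun t => if (i t : ℕ) ≤ j then N else 0]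

theorem finRotate_symm_ne {r : ℕ} (hr : 2 ≤ r) (t : Fin r) : (finRotate r).symm t ≠ t := by
  intro h
  rw [Equiv.symm_apply_eq] at h
  obtain ⟨r, rfl⟩ : ∃ r', r = r' + 1 := ⟨r - 1, by omega⟩
  have h1 := congrArg Fin.val h
  rw [coe_finRotate] at h1
  split_ifs at h1 with ht
  · rw [ht, Fin.val_last] at h1
    omega
  · omega

theorem exists_sum_rotate_ne {k r : ℕ} (hr : 2 ≤ r) (i : Fin r ↪ Fin (k + 1)) (N : ℕ)
    (t₀ : Fin r) : ∃ j : Fin k,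
    (∑ t, if (i ((finRotate r).symm (Tuple.sort i t)) : ℕ) ≤ j then N + (if t = t₀ then 1 else 0)
      else 0) ≠
      ∑ t, if (i (Tuple.sort i t) : ℕ) ≤ j then N + (if t = t₀ then 1 else 0) else 0 := by
  have hsum : ∀ P : Fin r → Prop, ∀ [DecidablePred P],
      (∑ t, if P t then N + (if t = t₀ then 1 else 0) else 0) =
        (∑ t, if P t then N else 0) + if P t₀ then 1 else 0 := by
    intro P _
    have h1 : (if P t₀ then 1 else 0) = ∑ t, if t = t₀ then (if P t then 1 else 0) else 0 := by
      rw [Finset.sum_ite_eq' Finset.univ t₀ (fun t => if P t then 1 else 0),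
        if_pos (Finset.mem_univ _)]
    rw [h1, ← Finset.sum_add_distrib]
    refine Finset.sum_congr rfl fun t _ => ?_
    split_ifs <;> rfl
  have hne : (i ((finRotate r).symm (Tuple.sort i t₀)) : ℕ) ≠ i (Tuple.sort i t₀) := fun h =>
    finRotate_symm_ne hr _ (i.injective (Fin.ext h))
  have h1 := (i ((finRotate r).symm (Tuple.sort i t₀))).isLt
  have h2 := (i (Tuple.sort i t₀)).isLt
  -- The row and column of block `t₀` differ. Cutting at the smaller index counts the extra point on
  -- one side only, and this index is below `k` because the larger one is at most `k`.
  refine ⟨⟨min (i ((finRotate r).symm (Tuple.sort i t₀))) (i (Tuple.sort i t₀)), by omega⟩, ?_⟩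
  rw [hsum, hsum, sum_const_rotate_eq]
  dsimp only
  split_ifs <;> omega

theorem exists_notMem_of_definable {k : ℕ} {π : Equiv.Perm (Fin k)} {C : Set FinPerm}
    {φ : toto.Formula (Fin k)} (hφ : ∀ (n : ℕ) (σ : Equiv.Perm (Fin n)), ⟨n, σ⟩ ∈ C →
      ∀ s : Fin k → Fin n, Satisfies σ s φ ↔ IsStableOccurrence π σ s)
    {r : ℕ} (hr : 2 ≤ r) (i : Fin r ↪ Fin (k + 1)) (X : Fin r → Set FinPerm)
    (hX : ∀ t, X t = increasingClass ∨ X t = decreasingClass) :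
    ∃ τ ∈ expansionClass π i X, τ ∉ C := by
  by_contra! hcon
  have hd : ∀ t, ∃ d, X t = monotoneClass d := fun t => by
    rcases hX t with h | h
    · exact ⟨true, h⟩
    · exact ⟨false, h⟩
  choose d hd using hd
  have hmem : ∀ N : Fin r → ℕ, expansionInflation π i (fun t => monotonePerm (d t) (N t)) ∈ C :=
    fun N => hcon _ ⟨_, fun t => by rw [hd]; exact monotonePerm_mem _ _, IsPattern.refl _⟩
  obtain ⟨q, hq⟩ := exists_realize_iff_of_gameEquivalent φ
  set N : Fin r → ℕ := fun _ => 2 ^ q with hN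
  -- The choice of the enlarged block is arbitrary; index `0` exists because `r ≥ 2`.
  set N' : Fin r → ℕ := fun t => 2 ^ q + if t = ⟨0, by omega⟩ then 1 else 0 with hN'
  have hE := hmem N
  have hE' := hmem N'
  rw [expansionInflation_monotonePerm] at hE hE'
  set D := inflateDecomposition (expansionX_injective i) (expansionY_injective π i)
    (Sum.elim (fun _ => true) d) (Sum.elim (fun _ => 1) N)
  set D' := inflateDecomposition (expansionX_injective i) (expansionY_injective π i)
    (Sum.elim (fun _ => true) d) (Sum.elim (fun _ => 1) N')
  choose s hs hsc using fun j => D.exists_coord (Sum.inl j) 1 (by norm_num) (by simp)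
  choose s' hs' hsc' using fun j => D'.exists_coord (Sum.inl j) 1 (by norm_num) (by simp)
  have hwin : IsWinning D D' q (Set.range fun j => (s j, s' j)) := by
    refine ⟨?_, ?_⟩
    · rintro _ ⟨j, rfl⟩
      exact (hs j).trans (hs' j).symm
    -- In the block of a point of `π`, the marked coordinates agree on both sides. In a new block
    -- only the two end points are marked, and their distance exceeds `2 ^ q` on both sides.
    · rintro (j | t)
      · have hdiag : ∀ u ∈ blockPairs D D' (Set.range fun j => (s j, s' j)) (Sum.inl j),
            u.1 = u.2 := by
          rintro u (rfl | rfl | ⟨_, ⟨j', rfl⟩, _, rfl⟩)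
          · rfl
          · rfl
          · exact (hsc j').trans (hsc' j').symm
        intro u hu w hw
        exact Or.inl (by rw [hdiag u hu, hdiag w hw])
      · have hends : ∀ u ∈ blockPairs D D' (Set.range fun j => (s j, s' j)) (Sum.inr t),
            u = (0, 0) ∨ u = ((N t : ℤ) + 1, (N' t : ℤ) + 1) := by
          rintro u (rfl | rfl | ⟨_, ⟨j', rfl⟩, hj', _⟩)
          · exact Or.inl rfl
          · exact Or.inr rfl
          · exact absurd ((hs j').symm.trans hj') (by simp)
        have h1 : (2 : ℤ) ^ q ≤ N t := by simp [hN]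
        have h2 : (2 : ℤ) ^ q ≤ N' t := by
          have : 2 ^ q ≤ N' t := Nat.le_add_right _ _
          exact_mod_cast this
        intro u hu w hw
        rcases hends u hu with rfl | rfl <;> rcases hends w hw with rfl | rfl
        · exact Or.inl rfl
        · exact Or.inr (Or.inr ⟨by dsimp only; omega, by dsimp only; omega⟩)
        · exact Or.inr (Or.inl ⟨by dsimp only; omega, by dsimp only; omega⟩)
        · exact Or.inl ((sub_self _).trans (sub_self _).symm)
  have hgame := hq _ _ _ _ _ hwin.gameEquivalent s s' default default (fun j => ⟨j, rfl⟩) (fun j => j.elim0)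
  have hiff := (isStableOccurrence_iff_of_block_eq D hs).symm.trans ((hφ _ _ hE s).symm.trans
    (hgame.trans ((hφ _ _ hE' s').trans (isStableOccurrence_iff_of_block_eq D' hs'))))
  obtain ⟨j, hj⟩ := exists_sum_rotate_ne hr i (2 ^ q) ⟨0, by omega⟩
  exact hj (hiff.mp (fun j => sum_const_rotate_eq i _ j) j)

/-! ### Definable predicates -/

/-- A predicate of tuples of elements of permutations that is expressed by a first-order formula. -/
def IsDefinable {α : Type} (P : ∀ n : ℕ, Equiv.Perm (Fin n) → (α → Fin n) → Prop) : Prop :=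
  ∃ φ : toto.Formula α, ∀ (n : ℕ) (σ : Equiv.Perm (Fin n)) (v : α → Fin n),
    (letI := totoStructure σ; φ.Realize v) ↔ P n σ v

section Definable

variable {α : Type} {P Q : ∀ n : ℕ, Equiv.Perm (Fin n) → (α → Fin n) → Prop}

theorem isDefinable_lt_pos (a b : α) :
    IsDefinable fun (n : ℕ) (_ : Equiv.Perm (Fin n)) v => v a < v b :=
  ⟨FirstOrder.Language.Relations.formula (L := toto) TotoRel.ltP
    ![FirstOrder.Language.Term.var a, FirstOrder.Language.Term.var b], fun _ _ _ => Iff.rfl⟩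

theorem isDefinable_lt_val (a b : α) :
    IsDefinable fun (n : ℕ) (σ : Equiv.Perm (Fin n)) v => σ (v a) < σ (v b) :=
  ⟨FirstOrder.Language.Relations.formula (L := toto) TotoRel.ltV
    ![FirstOrder.Language.Term.var a, FirstOrder.Language.Term.var b], fun _ _ _ => Iff.rfl⟩

theorem isDefinable_eq (a b : α) :
    IsDefinable fun (n : ℕ) (_ : Equiv.Perm (Fin n)) v => v a = v b :=
  ⟨(FirstOrder.Language.Term.var a).equal (FirstOrder.Language.Term.var b), fun n σ v => by
    let := totoStructure σ
    rw [FirstOrder.Language.Formula.realize_equal]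
    exact Iff.rfl⟩

theorem IsDefinable.not (hP : IsDefinable P) : IsDefinable fun n σ v => ¬ P n σ v := by
  obtain ⟨φ, hφ⟩ := hP
  refine ⟨φ.not, fun n σ v => ?_⟩
  let := totoStructure σ
  rw [FirstOrder.Language.Formula.realize_not, hφ]

theorem IsDefinable.imp (hP : IsDefinable P) (hQ : IsDefinable Q) :
    IsDefinable fun n σ v => P n σ v → Q n σ v := by
  obtain ⟨φ, hφ⟩ := hP
  obtain ⟨ψ, hψ⟩ := hQ
  refine ⟨φ.imp ψ, fun n σ v => ?_⟩
  let := totoStructure σ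
  rw [FirstOrder.Language.Formula.realize_imp, hφ, hψ]

theorem IsDefinable.and (hP : IsDefinable P) (hQ : IsDefinable Q) :
    IsDefinable fun n σ v => P n σ v ∧ Q n σ v := by
  obtain ⟨φ, hφ⟩ := hP
  obtain ⟨ψ, hψ⟩ := hQ
  refine ⟨φ ⊓ ψ, fun n σ v => ?_⟩
  let := totoStructure σ
  rw [FirstOrder.Language.Formula.realize_inf, hφ, hψ]

theorem IsDefinable.iff (hP : IsDefinable P) (hQ : IsDefinable Q) :
    IsDefinable fun n σ v => P n σ v ↔ Q n σ v := by
  obtain ⟨φ, hφ⟩ := hP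
  obtain ⟨ψ, hψ⟩ := hQ
  refine ⟨φ.iff ψ, fun n σ v => ?_⟩
  let := totoStructure σ
  rw [FirstOrder.Language.Formula.realize_iff, hφ, hψ]

theorem isDefinable_const (p : Prop) :
    IsDefinable fun (n : ℕ) (_ : Equiv.Perm (Fin n)) (_ : α → Fin n) => p := by
  by_cases hp : p
  · exact ⟨⊤, fun n σ v => by
      let := totoStructure σ
      simp [hp]⟩
  · exact ⟨⊥, fun n σ v => by
      let := totoStructure σ
      simp [hp]⟩

theorem IsDefinable.forall_finite {β : Type} [Finite β]
    {P : β → ∀ n : ℕ, Equiv.Perm (Fin n) → (α → Fin n) → Prop} (hP : ∀ b, IsDefinable (P b)) :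
    IsDefinable fun n σ v => ∀ b, P b n σ v := by
  choose φ hφ using hP
  refine ⟨FirstOrder.Language.Formula.iInf φ, fun n σ v => ?_⟩
  let := totoStructure σ
  rw [FirstOrder.Language.Formula.realize_iInf]
  exact forall_congr' fun b => hφ b n σ v

theorem IsDefinable.exists_finite {β : Type} [Finite β]
    {P : β → ∀ n : ℕ, Equiv.Perm (Fin n) → (α → Fin n) → Prop} (hP : ∀ b, IsDefinable (P b)) :
    IsDefinable fun n σ v => ∃ b, P b n σ v := by
  choose φ hφ using hP
  refine ⟨FirstOrder.Language.Formula.iSup φ, fun n σ v => ?_⟩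
  let := totoStructure σ
  rw [FirstOrder.Language.Formula.realize_iSup]
  exact exists_congr fun b => hφ b n σ v

theorem IsDefinable.exists_tuple {β : Type} [Finite β]
    {P : ∀ n : ℕ, Equiv.Perm (Fin n) → (α ⊕ β → Fin n) → Prop} (hP : IsDefinable P) :
    IsDefinable fun n σ v => ∃ w : β → Fin n, P n σ (Sum.elim v w) := by
  obtain ⟨φ, hφ⟩ := hP
  refine ⟨φ.iExs β, fun n σ v => ?_⟩
  let := totoStructure σ
  rw [FirstOrder.Language.Formula.realize_iExs]
  exact exists_congr fun w => hφ n σ _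

theorem IsDefinable.relabel {β : Type} (f : α → β) (hP : IsDefinable P) :
    IsDefinable fun n σ v => P n σ (v ∘ f) := by
  obtain ⟨φ, hφ⟩ := hP
  refine ⟨φ.relabel f, fun n σ v => ?_⟩
  let := totoStructure σ
  rw [FirstOrder.Language.Formula.realize_relabel, hφ]

theorem IsDefinable.congr (hP : IsDefinable P) (h : ∀ n σ v, P n σ v ↔ Q n σ v) :
    IsDefinable Q := by
  obtain ⟨φ, hφ⟩ := hP
  exact ⟨φ, fun n σ v => (hφ n σ v).trans (h n σ v)⟩

/-- For fixed `m`, having at least `m` solutions means that an injective `m`-tuple of solutions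
exists. -/
theorem isDefinable_le_card {P : ∀ n : ℕ, Equiv.Perm (Fin n) → (α → Fin n) → Fin n → Prop}
    [∀ n σ v, DecidablePred (P n σ v)]
    (hP : IsDefinable fun n σ (v : α ⊕ Unit → Fin n) =>
      P n σ (fun a => v (Sum.inl a)) (v (Sum.inr ()))) (m : ℕ) :
    IsDefinable fun n σ v => m ≤ (Finset.univ.filter fun p => P n σ v p).card := by
  have h1 : IsDefinable fun (n : ℕ) (σ : Equiv.Perm (Fin n)) v => ∃ w : Fin m → Fin n,
      (∀ z : Fin m × Fin m, Sum.elim v w (Sum.inr z.1) = Sum.elim v w (Sum.inr z.2) → z.1 = z.2) ∧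
      ∀ z : Fin m, P n σ (fun a => Sum.elim v w (Sum.inl a)) (Sum.elim v w (Sum.inr z)) :=
    IsDefinable.exists_tuple
      (P := fun n σ v => (∀ z : Fin m × Fin m, v (Sum.inr z.1) = v (Sum.inr z.2) → z.1 = z.2) ∧
        ∀ z : Fin m, P n σ (fun a => v (Sum.inl a)) (v (Sum.inr z)))
      ((IsDefinable.forall_finite fun z => (isDefinable_eq _ _).imp (isDefinable_const _)).and
        (IsDefinable.forall_finite fun z => hP.relabel (Sum.map id fun _ => z)))
  refine h1.congr fun n σ v => ?_
  simp only [Sum.elim_inl, Sum.elim_inr, Prod.forall]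
  constructor
  · rintro ⟨w, hw, hPw⟩
    rw [← Fintype.card_fin m, ← Finset.card_univ]
    exact Finset.card_le_card_of_injOn w (fun z _ => Finset.mem_coe.mpr
      (Finset.mem_filter.mpr ⟨Finset.mem_univ _, hPw z⟩)) fun z _ z' _ h => hw z z' h
  · intro hm
    obtain ⟨T, hT, hc⟩ := Finset.exists_subset_card_eq hm
    refine ⟨fun z => T.orderEmbOfFin hc z, fun z z' h => (T.orderEmbOfFin hc).injective h,
      fun z => (Finset.mem_filter.mp (hT (T.orderEmbOfFin_mem hc z))).2⟩

theorem isDefinable_card_eq {P : ∀ n : ℕ, Equiv.Perm (Fin n) → (α → Fin n) → Fin n → Prop}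
    [∀ n σ v, DecidablePred (P n σ v)]
    (hP : IsDefinable fun n σ (v : α ⊕ Unit → Fin n) =>
      P n σ (fun a => v (Sum.inl a)) (v (Sum.inr ()))) (m : ℕ) :
    IsDefinable fun n σ v => (Finset.univ.filter fun p => P n σ v p).card = m :=
  ((isDefinable_le_card hP m).and (isDefinable_le_card hP (m + 1)).not).congr fun n σ v => by
    omega

/-- The cardinality of a set of indices cut out by definable conditions is definable. -/
theorem isDefinable_card_filter_index {k : ℕ}
    {P : Fin k → ∀ n : ℕ, Equiv.Perm (Fin n) → (α → Fin n) → Prop}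
    [∀ t n σ v, Decidable (P t n σ v)] (hP : ∀ t, IsDefinable (P t)) (m : ℕ) :
    IsDefinable fun n σ v => (Finset.univ.filter fun t => P t n σ v).card = m := by
  have h1 : IsDefinable fun n σ v => ∃ T : Finset (Fin k), T.card = m ∧
      ∀ t, t ∈ T ↔ P t n σ v :=
    IsDefinable.exists_finite fun T => (isDefinable_const _).and
      (IsDefinable.forall_finite fun t => (isDefinable_const _).iff (hP t))
  refine h1.congr fun n σ v => ⟨?_, fun h => ⟨_, h, fun t => by simp⟩⟩
  rintro ⟨T, hT, hmem⟩
  rw [← hT]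
  congr 1
  ext t
  simp [hmem]

end Definable

theorem isDefinable_cellMatrix_eq {k : ℕ} (a b : Fin (k + 1)) (m : ℕ) :
    IsDefinable fun (n : ℕ) (σ : Equiv.Perm (Fin n)) (s : Fin k → Fin n) =>
      cellMatrix σ s a b = m := by
  refine isDefinable_card_eq (P := fun n σ s p => (∀ t, p ≠ s t) ∧
    gridIndex (fun t => σ (s t)) (σ p) = a ∧ gridIndex s p = b) ?_ m
  refine (IsDefinable.forall_finite fun t => (isDefinable_eq _ _).not).and (IsDefinable.and ?_ ?_)
  · exact (isDefinable_card_filter_index (fun t => isDefinable_lt_val (Sum.inl t) (Sum.inr ()))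
      (a : ℕ)).congr fun n σ v => (Fin.ext_iff (a := gridIndex _ _) (b := a)).symm
  · exact (isDefinable_card_filter_index (fun t => isDefinable_lt_pos (Sum.inl t) (Sum.inr ()))
      (b : ℕ)).congr fun n σ v => (Fin.ext_iff (a := gridIndex _ _) (b := b)).symm

theorem isDefinable_isOccurrence {k : ℕ} (π : Equiv.Perm (Fin k)) :
    IsDefinable fun (n : ℕ) (σ : Equiv.Perm (Fin n)) (s : Fin k → Fin n) =>
      IsOccurrence π σ s := by
  have h1 : IsDefinable fun (n : ℕ) (σ : Equiv.Perm (Fin n)) (s : Fin k → Fin n) =>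
      (∀ a b : Fin k, a < b → s a < s b) ∧ ∀ a b : Fin k, π a < π b ↔ σ (s a) < σ (s b) :=
    (IsDefinable.forall_finite fun a => IsDefinable.forall_finite fun b =>
      (isDefinable_const _).imp (isDefinable_lt_pos a b)).and
    (IsDefinable.forall_finite fun a => IsDefinable.forall_finite fun b =>
      (isDefinable_const _).iff (isDefinable_lt_val a b))
  exact h1.congr fun n σ s => ⟨fun h => ⟨fun a b => h.1 a b, h.2⟩,
    fun h => ⟨fun a b hab => h.strictMono hab, h.lt_iff⟩⟩

theorem exists_formula_of_bound {k : ℕ} {π : Equiv.Perm (Fin k)} {C : Set FinPerm} {M : ℕ}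
    (hM : ∀ (n : ℕ) (σ : Equiv.Perm (Fin n)), ⟨n, σ⟩ ∈ C →
      ∀ s : Fin k → Fin n, IsStableOccurrence π σ s → offDiagSum (cellMatrix σ s) ≤ M) :
    ∃ φ : toto.Formula (Fin k), ∀ (n : ℕ) (σ : Equiv.Perm (Fin n)), ⟨n, σ⟩ ∈ C →
      ∀ s : Fin k → Fin n, Satisfies σ s φ ↔ IsStableOccurrence π σ s := by
  obtain ⟨φ, hφ⟩ : IsDefinable fun (n : ℕ) (σ : Equiv.Perm (Fin n)) (s : Fin k → Fin n) =>
      -- Diagonal entries may be unbounded and are left out, since balance does not depend on them.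
      -- Whether `B` is balanced does not depend on the permutation, so that condition is a
      -- constant.
      IsOccurrence π σ s ∧ ∃ B : Fin (k + 1) → Fin (k + 1) → Fin (M + 1),
        IsBalanced (offDiag fun a b => (B a b : ℕ)) ∧
          ∀ a b, a ≠ b → cellMatrix σ s a b = B a b :=
    (isDefinable_isOccurrence π).and (IsDefinable.exists_finite fun B =>
      (isDefinable_const _).and (IsDefinable.forall_finite fun a =>
        IsDefinable.forall_finite fun b =>
          (isDefinable_const _).imp (isDefinable_cellMatrix_eq a b _)))
  have hoff : ∀ A B : Fin (k + 1) → Fin (k + 1) → ℕ, (∀ a b, a ≠ b → A a b = B a b) →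
      offDiag A = offDiag B := by
    intro A B h
    funext a b
    unfold offDiag
    split_ifs with hab
    · rfl
    · exact h a b hab
  refine ⟨φ, fun n σ hσ s => (hφ n σ s).trans ⟨?_, fun h => ⟨h.toIsOccurrence, ?_⟩⟩⟩
  -- This direction holds in every permutation; the bound `M` serves only the converse, where it
  -- provides `B`.
  · rintro ⟨hocc, B, hB, hAB⟩
    rw [← hoff _ _ hAB] at hB
    exact hocc.isStableOccurrence_of_isBalanced (isBalanced_offDiag_iff.mp hB)
  · have hle : ∀ a b, offDiag (cellMatrix σ s) a b ≤ M := fun a b =>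
      (Finset.single_le_sum (f := fun b => offDiag (cellMatrix σ s) a b)
        (fun _ _ => Nat.zero_le _) (Finset.mem_univ b)).trans
      ((Finset.single_le_sum (f := fun a => ∑ b, offDiag (cellMatrix σ s) a b)
        (fun _ _ => Nat.zero_le _) (Finset.mem_univ a)).trans (hM n σ hσ s h))
    have hval : ∀ a b, a ≠ b → cellMatrix σ s a b = offDiag (cellMatrix σ s) a b :=
      fun a b hab => (if_neg hab).symm
    refine ⟨fun a b => ⟨offDiag (cellMatrix σ s) a b, Nat.lt_succ_of_le (hle a b)⟩, ?_, hval⟩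
    rw [← hoff _ _ hval]
    exact isBalanced_offDiag_iff.mpr h.isBalanced

end TwoOrders

theorem mainTheorem5 {k : ℕ} (π : Equiv.Perm (Fin k)) (C : Set TwoOrders.FinPerm)
    (hC : TwoOrders.IsPermClass C) :
    List.TFAE [
      ∃ φ : TwoOrders.toto.Formula (Fin k), ∀ (n : ℕ) (σ : Equiv.Perm (Fin n)), ⟨n, σ⟩ ∈ C →
        ∀ s : Fin k → Fin n,
          TwoOrders.Satisfies σ s φ ↔ TwoOrders.IsStableOccurrence π σ s,
      ∀ (r : ℕ), 2 ≤ r → ∀ (i : Fin r ↪ Fin (k + 1)) (X : Fin r → Set TwoOrders.FinPerm),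
        (∀ t, X t = TwoOrders.increasingClass ∨ X t = TwoOrders.decreasingClass) →
          ∃ τ ∈ TwoOrders.expansionClass π i X, τ ∉ C,
      ∃ M : ℕ, 0 < M ∧ ∀ (n : ℕ) (σ : Equiv.Perm (Fin n)), ⟨n, σ⟩ ∈ C →
        ∀ s : Fin k → Fin n, TwoOrders.IsStableOccurrence π σ s →
          TwoOrders.offDiagSum (TwoOrders.cellMatrix σ s) ≤ M] := by
  tfae_have 1 → 2
  | ⟨_, hφ⟩, _, hr, i, X, hX => TwoOrders.exists_notMem_of_definable hφ hr i X hX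
  tfae_have 2 → 3
  | hav => TwoOrders.exists_bound_offDiagSum hC hav
  tfae_have 3 → 1
  | ⟨_, _, hM⟩ => TwoOrders.exists_formula_of_bound hM
  tfae_finish
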